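/- **Definitions.** Let $\Sigma$ be a finite alphabet with $n$ letters. The *coin-flip measure* of a language $L\subseteq\Sigma^*$ is $$\mu_{\mathrm{coin}}(L)=\sum_{w\in L}\Bigl(\frac1{n+1}\Bigr)^{|w|+1}\in[0,1].$$ A context-free grammar $G$ is *unambiguous* (a UCFG) if every word of its language $\mathcal L(G)$ has exactly one derivation tree in $G$. *Coin-flip measure comparison problem for UCFG:* given an unambiguous context-free grammar $G$ over a finite alphabet (the alphabet being part of the input, and the size of the grammar counting its letters, nonterminals and productions), a rational threshold $0\le\varepsilon\le1$ encoded in binary, and a comparison operator ${\sim}\in\{\le,<,>,\ge\}$, decide whether $\mu_{\mathrm{coin}}(\mathcal L(G))\sim\varepsilon$. *SQRTSUM:* given $d_0,d_1,\dots,d_n\in\mathbb N$ encoded in binary and a comparison operator ${\sim}\in\{\le,<,>,\ge\}$, decide whether $\sum_{i=1}^n\sqrt{d_i}\sim d_0$. **Theorem.** The coin-flip measure comparison problem is SQRTSUM-hard for UCFG: there is a function, computable by a Turing machine in polynomial time, that maps every instance of SQRTSUM to an instance of the coin-flip measure comparison problem for UCFG such that the answer to the former is positive if and only if the answer to the latter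 is positive. -/

import Mathlib

/-! ### Comparison operators -/

/-- The four comparison operators `≤`, `<`, `>`, `≥`. -/
inductive CompOp where
  | le
  | lt
  | gt
  | ge
  deriving DecidableEq

instance : Fintype CompOp where
  elems := {.le, .lt, .gt, .ge}
  complete r := by cases r <;> simp

/-- `r.Rel x y` says that `x ∼ y`, where `∼` is the comparison operator denoted by `r`. -/
def CompOp.Rel : CompOp → ℝ → ℝ → Prop
  | .le, x, y => x ≤ y
  | .lt, x, y => x < y
  | .gt, x, y => x > y
  | .ge, x, y => x ≥ y

/-! ### Derivation trees and unambiguous context-free grammars -/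

/-- Finite ordered trees whose leaves carry terminals and whose inner nodes carry nonterminals.
A node without children is the left-hand side of an empty production. -/
inductive DerivTree (T N : Type) where
  | leaf (a : T) : DerivTree T N
  | node (X : N) (children : List (DerivTree T N)) : DerivTree T N

namespace DerivTree

variable {T : Type}

/-- The label of the root. -/
def root {N : Type} : DerivTree T N → Symbol T N
  | .leaf a => .terminal a
  | .node X _ => .nonterminal X

/-- The word of terminals on the leaves, read from left to right. -/
def yield {N : Type} : DerivTree T N → List T
  | .leaf a => [a]
  | .node _ ts => ts.flatMap yield

/-- At every inner node labelled `X` whose children are labelled `w₁, …, wₖ`,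
the grammar has the production `X ← w₁ ⋯ wₖ`. -/
inductive Valid (g : ContextFreeGrammar T) : DerivTree T g.NT → Prop
  | leaf (a : T) : Valid g (.leaf a)
  | node (X : g.NT) (ts : List (DerivTree T g.NT))
      (hrule : (⟨X, ts.map root⟩ : ContextFreeRule T g.NT) ∈ g.rules)
      (hts : ∀ t ∈ ts, Valid g t) : Valid g (.node X ts)

end DerivTree

/-- `t` is a derivation tree of the word `w` in the grammar `g`, rooted at the start symbol. -/
def ContextFreeGrammar.IsDerivTree {T : Type} (g : ContextFreeGrammar T)
    (t : DerivTree T g.NT) (w : List T) : Prop :=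
  t.Valid g ∧ t.root = .nonterminal g.initial ∧ t.yield = w

/-- A grammar is unambiguous if every word of its language has exactly one derivation tree. -/
def ContextFreeGrammar.Unambiguous {T : Type} (g : ContextFreeGrammar T) : Prop :=
  ∀ w ∈ g.language, ∃! t : DerivTree T g.NT, g.IsDerivTree t w

/-! The words of the language are exactly the words that have a derivation tree. -/

theorem ContextFreeGrammar.derives_of_valid {T : Type} (g : ContextFreeGrammar T)
    {t : DerivTree T g.NT} (h : t.Valid g) :
    g.Derives [t.root] (t.yield.map Symbol.terminal) := by
  induction h with
  | leaf a => simpa [DerivTree.root, DerivTree.yield] using Relation.ReflTransGen.refl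
  | node X ts hrule hts ih =>
    have key : ∀ l : List (DerivTree T g.NT),
        (∀ t ∈ l, g.Derives [t.root] (t.yield.map Symbol.terminal)) →
        g.Derives (l.map DerivTree.root)
          ((l.flatMap DerivTree.yield).map Symbol.terminal) := by
      intro l
      induction l with
      | nil => intro _; exact Relation.ReflTransGen.refl
      | cons t l ihl =>
        intro hl
        have h1 := (hl t (by simp)).append_right (l.map DerivTree.root)
        have h2 := (ihl fun s hs => hl s (by simp [hs])).append_left
          (t.yield.map Symbol.terminal)
        simpa using h1.trans h2
    have h0 : g.Produces [Symbol.nonterminal X] (ts.map DerivTree.root) :=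
      ⟨_, hrule, ContextFreeRule.Rewrites.input_output⟩
    simpa [DerivTree.root, DerivTree.yield] using
      (ContextFreeGrammar.Produces.single h0).trans (key ts ih)

theorem ContextFreeGrammar.exists_trees_of_derives {T : Type} (g : ContextFreeGrammar T)
    {s : List (Symbol T g.NT)} {w : List T} (h : g.Derives s (w.map Symbol.terminal)) :
    ∃ ts : List (DerivTree T g.NT), ts.map DerivTree.root = s ∧ (∀ t ∈ ts, t.Valid g) ∧
      ts.flatMap DerivTree.yield = w := by
  induction h using Relation.ReflTransGen.head_induction_on with
  | refl =>
    refine ⟨w.map DerivTree.leaf, by simp [DerivTree.root, Function.comp_def], ?_, ?_⟩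
    · intro t ht
      obtain ⟨a, -, rfl⟩ := List.mem_map.1 ht
      exact .leaf a
    · simp [DerivTree.yield, List.flatMap_map]
  | head hab _ ih =>
    obtain ⟨r, hr, hrw⟩ := hab
    obtain ⟨p, q, rfl, rfl⟩ := hrw.exists_parts
    obtain ⟨ts, h1, h2, h3⟩ := ih
    obtain ⟨tpo, tq, rfl, hpo, hq⟩ := List.map_eq_append_iff.1 h1
    obtain ⟨tp, tr, rfl, hp, ho⟩ := List.map_eq_append_iff.1 hpo
    refine ⟨tp ++ [.node r.input tr] ++ tq, by simp [hp, hq, DerivTree.root], ?_, ?_⟩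
    · intro t ht
      simp only [List.mem_append, List.mem_singleton] at ht h2
      rcases ht with (ht | rfl) | ht
      · exact h2 t (by simp [ht])
      · exact .node _ _ (by rw [ho]; exact hr) fun t ht => h2 t (by simp [ht])
      · exact h2 t (by simp [ht])
    · simpa [DerivTree.yield] using h3

theorem ContextFreeGrammar.mem_language_iff_exists_derivTree {T : Type}
    (g : ContextFreeGrammar T) (w : List T) :
    w ∈ g.language ↔ ∃ t : DerivTree T g.NT, g.IsDerivTree t w := by
  constructor
  · intro h
    obtain ⟨ts, h1, h2, h3⟩ := g.exists_trees_of_derives h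
    obtain ⟨t, rfl, ht⟩ := List.map_eq_singleton_iff.1 h1
    exact ⟨t, h2 t (by simp), ht, by simpa using h3⟩
  · rintro ⟨t, h1, h2, rfl⟩
    have := g.derives_of_valid h1
    rwa [h2] at this

/-! ### The coin-flip measure -/

/-- The coin-flip measure `∑_{w ∈ L} (1 / (|Σ| + 1)) ^ (|w| + 1)` of a language `L ⊆ Σ*`. -/
noncomputable def coinFlipMeasure {T : Type} [Fintype T] (L : Language T) : ℝ :=
  ∑' w : {w : List T // w ∈ L}, (1 / ((Fintype.card T : ℝ) + 1)) ^ (w.val.length + 1)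

/-- The series that defines the coin-flip measure converges. -/
theorem summable_coinFlipMeasure {T : Type} [Fintype T] (L : Language T) :
    Summable fun w : {w : List T // w ∈ L} =>
      (1 / ((Fintype.card T : ℝ) + 1)) ^ (w.val.length + 1) := by
  set r : ℝ := 1 / ((Fintype.card T : ℝ) + 1) with hr
  have hr0 : 0 < r := by positivity
  suffices h : Summable fun w : List T => r ^ (w.length + 1) from h.subtype {w | w ∈ L}
  rw [← (Equiv.sigmaFiberEquiv (List.length : List T → ℕ)).summable_iff]
  have hfib : ∀ n : ℕ, ∀ w : {w : List T // w.length = n},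
      r ^ (w.val.length + 1) = r ^ (n + 1) := fun n w => by rw [w.2]
  have hcard : ∀ n : ℕ, (∑' _ : {w : List T // w.length = n}, r ^ (n + 1)) =
      r * ((Fintype.card T : ℝ) * r) ^ n := by
    intro n
    have h1 : Nat.card {w : List T // w.length = n} = Fintype.card T ^ n := by
      rw [← card_vector, ← Nat.card_eq_fintype_card]; rfl
    rw [tsum_const, h1, nsmul_eq_mul]
    push_cast
    ring
  rw [summable_sigma_of_nonneg (fun _ => by simp only [Function.comp_apply]; positivity)]
  constructor
  · intro n
    have : Finite {w : List T // w.length = n} := inferInstanceAs (Finite (List.Vector T n))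
    exact Summable.of_finite
  · have : ∀ n : ℕ, (∑' w : {w : List T // w.length = n}, r ^ (w.val.length + 1)) =
        r * ((Fintype.card T : ℝ) * r) ^ n := fun n => by
      rw [← hcard]; exact tsum_congr (hfib n)
    simp only [Function.comp_apply, Equiv.sigmaFiberEquiv_apply, this]
    refine (summable_geometric_of_lt_one (by positivity) ?_).mul_left r
    rw [hr, mul_one_div, div_lt_one (by positivity)]
    linarith

/-! ### Finite presentations and their encodings as words -/

/-- The alphabet of the words that are fed to, and produced by, Turing machines. -/
inductive Token where
  | bit (b : Bool)
  | tick
  | comma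
  | term
  | nonterm
  | rule
  | fin
  | op (r : CompOp)
  deriving DecidableEq, Fintype

/-- A natural number in binary, least significant bit first. -/
def encodeBinary (d : ℕ) : List Token :=
  d.bits.map Token.bit ++ [.comma]

/-- A natural number in unary. -/
def encodeUnary (i : ℕ) : List Token :=
  List.replicate i .tick ++ [.comma]

/-- A finite presentation of a context-free grammar with terminals `Σₙ = {a₀, …, aₙ₋₁}` and
nonterminals `{X₀, …, Xₖ₋₁}`, with a list of its productions. -/
structure CFGPresentation where
  /-- the number of terminals -/
  n : ℕ
  /-- the number of nonterminals -/
  k : ℕ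
  /-- the starting nonterminal -/
  start : Fin k
  /-- the productions -/
  rules : List (ContextFreeRule (Fin n) (Fin k))

/-- The presented grammar. -/
abbrev CFGPresentation.grammar (G : CFGPresentation) : ContextFreeGrammar (Fin G.n) where
  NT := Fin G.k
  initial := G.start
  rules := G.rules.toFinset

/-- Letters and nonterminals are written as a marker followed by their index in unary. -/
def encodeSymbol {n k : ℕ} : Symbol (Fin n) (Fin k) → List Token
  | .terminal a => .term :: encodeUnary a
  | .nonterminal X => .nonterm :: encodeUnary X

/-- A production: its left-hand side, then its right-hand side symbol by symbol. -/
def encodeRule {n k : ℕ} (r : ContextFreeRule (Fin n) (Fin k)) : List Token :=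
  .rule :: (encodeUnary r.input ++ (r.output.flatMap encodeSymbol ++ [.fin]))

/-- The numbers of terminals and nonterminals in unary, the starting nonterminal, and the
productions one after the other. -/
def CFGPresentation.encode (G : CFGPresentation) : List Token :=
  encodeUnary G.n ++ (encodeUnary G.k ++ (encodeUnary G.start ++
    (G.rules.flatMap encodeRule ++ [.fin])))

/-! ### Decision problems and polynomial-time reductions -/

/-- A decision problem: a type of instances, an injective encoding of the instances as words over
a finite alphabet, and the set of yes-instances. -/
structure DecisionProblem where
  /-- the instances -/
  Instance : Type
  /-- the alphabet in which instances are written -/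
  Alphabet : Type
  [alphabetFintype : Fintype Alphabet]
  /-- the word that encodes an instance -/
  encode : Instance → List Alphabet
  encode_injective : Function.Injective encode
  /-- the instances with a positive answer -/
  Yes : Instance → Prop

/-- `P.PolyTimeReduces Q` : there is a many-one reduction from `P` to `Q` that is computed by a
Turing machine in time polynomial in the length of the encoded instance. -/
def DecisionProblem.PolyTimeReduces (P Q : DecisionProblem) : Prop :=
  ∃ f : P.Instance → Q.Instance,
    Nonempty (Turing.TM2ComputableInPolyTime P.encode Q.encode f) ∧
    ∀ x, P.Yes x ↔ Q.Yes (f x)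

/-- `Q` is `P`-hard: `P` reduces to `Q` in polynomial time. -/
def DecisionProblem.HardFor (Q P : DecisionProblem) : Prop :=
  P.PolyTimeReduces Q

/-! ### The problem SQRTSUM -/

/-- An instance of SQRTSUM: natural numbers `d₀` and `d₁, …, dₙ`, and a comparison operator. -/
structure SqrtSumInstance where
  op : CompOp
  d₀ : ℕ
  ds : List ℕ

/-- The comparison operator, then `d₀` and `d₁, …, dₙ` in binary. -/
def SqrtSumInstance.encode (x : SqrtSumInstance) : List Token :=
  .op x.op :: (encodeBinary x.d₀ ++ (x.ds.flatMap encodeBinary ++ [.fin]))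

/-- `√d₁ + ⋯ + √dₙ ∼ d₀`. -/
def SqrtSumInstance.Yes (x : SqrtSumInstance) : Prop :=
  x.op.Rel ((x.ds.map fun d => Real.sqrt (d : ℝ)).sum) (x.d₀ : ℝ)

/-! ### The coin-flip measure comparison problem for unambiguous grammars -/

/-- An instance of the comparison problem: an unambiguous context-free grammar, a comparison
operator, and a rational threshold `p / q` in the interval `[0, 1]`. -/
structure CoinFlipInstance where
  op : CompOp
  p : ℕ
  q : ℕ
  q_pos : 0 < q
  p_le_q : p ≤ q
  G : CFGPresentation
  unambiguous : G.grammar.Unambiguous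

/-- The comparison operator, the threshold in binary, and the grammar. -/
def CoinFlipInstance.encode (x : CoinFlipInstance) : List Token :=
  .op x.op :: (encodeBinary x.p ++ (encodeBinary x.q ++ x.G.encode))

/-- `μ_coin(L(G)) ∼ p / q`. -/
def CoinFlipInstance.Yes (x : CoinFlipInstance) : Prop :=
  x.op.Rel (coinFlipMeasure x.G.grammar.language) ((x.p : ℝ) / (x.q : ℝ))

/-! ### The encodings are injective -/

/-- An encoding is a prefix code if the first codeword of a stream can be read off uniquely. -/
def IsPrefixCode {α : Type} (enc : α → List Token) : Prop :=
  ∀ a b s t, enc a ++ s = enc b ++ t → a = b ∧ s = t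

theorem IsPrefixCode.list {α : Type} {enc : α → List Token} {e : Token} (h : IsPrefixCode enc)
    (hne : ∀ a s, enc a ≠ [] ∧ enc a ≠ e :: s) :
    IsPrefixCode fun l : List α => l.flatMap enc ++ [e] := by
  intro l
  induction l with
  | nil =>
    rintro (_ | ⟨b, m⟩) s t hst
    · simpa using hst
    · exfalso
      have := hne b
      rcases hb : enc b with _ | ⟨c, u⟩
      · exact (this []).1 hb
      · simp only [List.flatMap_nil, List.flatMap_cons, hb, List.nil_append, List.cons_append,
          List.cons.injEq] at hst
        exact (this u).2 (hst.1 ▸ hb)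
  | cons a l ih =>
    rintro (_ | ⟨b, m⟩) s t hst
    · exfalso
      have := hne a
      rcases hb : enc a with _ | ⟨c, u⟩
      · exact (this []).1 hb
      · simp only [List.flatMap_nil, List.flatMap_cons, hb, List.nil_append, List.cons_append,
          List.cons.injEq] at hst
        exact (this u).2 (hst.1 ▸ hb)
    · simp only [List.flatMap_cons, List.append_assoc] at hst
      obtain ⟨rfl, h2⟩ := h _ _ _ _ hst
      obtain ⟨rfl, h3⟩ := ih m s t (by simpa using h2)
      exact ⟨rfl, h3⟩

theorem isPrefixCode_encodeUnary : IsPrefixCode encodeUnary := by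
  intro a
  induction a with
  | zero => rintro (_ | b) s t h <;> simp_all [encodeUnary, List.replicate_succ]
  | succ a ih =>
    rintro (_ | b) s t h
    · simp [encodeUnary, List.replicate_succ] at h
    · obtain ⟨rfl, h2⟩ := ih b s t (by simpa [encodeUnary, List.replicate_succ] using h)
      exact ⟨rfl, h2⟩

theorem isPrefixCode_encodeBinary : IsPrefixCode encodeBinary := by
  have h : IsPrefixCode fun b : Bool => [Token.bit b] := by
    intro a b s t h
    simpa using h
  intro a b s t hst
  have key := h.list (e := .comma) (by simp) a.bits b.bits s t
    (by simpa [encodeBinary, List.flatMap_singleton', ← List.map_eq_flatMap] using hst)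
  refine ⟨?_, key.2⟩
  have h2 := congrArg (fun l => Nat.ofDigits 2 (l.map fun b : Bool => cond b 1 0)) key.1
  simpa [← Nat.digits_two_eq_bits, Nat.ofDigits_digits] using h2

theorem isPrefixCode_encodeSymbol {n k : ℕ} :
    IsPrefixCode (encodeSymbol : Symbol (Fin n) (Fin k) → List Token) := by
  rintro (a | a) (b | b) s t h <;> simp [encodeSymbol] at h ⊢ <;>
    simpa [Fin.ext_iff] using isPrefixCode_encodeUnary _ _ _ _ h

theorem isPrefixCode_encodeRule {n k : ℕ} :
    IsPrefixCode (encodeRule : ContextFreeRule (Fin n) (Fin k) → List Token) := by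
  rintro ⟨X, u⟩ ⟨Y, v⟩ s t h
  simp only [encodeRule, List.cons_append, List.append_assoc, List.cons.injEq, true_and] at h
  obtain ⟨h1, h2⟩ := isPrefixCode_encodeUnary _ _ _ _ h
  obtain ⟨rfl, h3⟩ := isPrefixCode_encodeSymbol.list (e := .fin)
    (by rintro (a | a) s <;> simp [encodeSymbol]) u v s t (by simpa using h2)
  exact ⟨by simp [Fin.ext_iff, h1], h3⟩

theorem CFGPresentation.encode_injective : Function.Injective CFGPresentation.encode := by
  rintro ⟨n, k, S, R⟩ ⟨n', k', S', R'⟩ h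
  simp only [CFGPresentation.encode] at h
  obtain ⟨rfl, h⟩ := isPrefixCode_encodeUnary _ _ _ _ h
  obtain ⟨rfl, h⟩ := isPrefixCode_encodeUnary _ _ _ _ h
  obtain ⟨hS, h⟩ := isPrefixCode_encodeUnary _ _ _ _ h
  obtain ⟨rfl, -⟩ := isPrefixCode_encodeRule.list (e := .fin)
    (by intro a s; simp [encodeRule]) R R' [] [] (by simpa using h)
  simp [Fin.ext_iff, hS]

theorem SqrtSumInstance.encode_injective : Function.Injective SqrtSumInstance.encode := by
  rintro ⟨r, d, l⟩ ⟨r', d', l'⟩ h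
  simp only [SqrtSumInstance.encode, List.cons.injEq, Token.op.injEq] at h
  obtain ⟨rfl, h⟩ := h
  obtain ⟨rfl, h⟩ := isPrefixCode_encodeBinary _ _ _ _ h
  obtain ⟨rfl, -⟩ := isPrefixCode_encodeBinary.list (e := .fin)
    (by intro a s; rcases hb : a.bits with _ | ⟨b, u⟩ <;> simp [encodeBinary, hb])
    l l' [] [] (by simpa using h)
  rfl

theorem CoinFlipInstance.encode_injective : Function.Injective CoinFlipInstance.encode := by
  rintro ⟨r, p, q, _, _, G, _⟩ ⟨r', p', q', _, _, G', _⟩ h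
  simp only [CoinFlipInstance.encode, List.cons.injEq, Token.op.injEq] at h
  obtain ⟨rfl, h⟩ := h
  obtain ⟨hp, h⟩ := isPrefixCode_encodeBinary _ _ _ _ h
  obtain ⟨hq, h⟩ := isPrefixCode_encodeBinary _ _ _ _ h
  obtain hG := CFGPresentation.encode_injective h
  subst hp hq hG
  rfl

/-! ### The two decision problems -/

/-- SQRTSUM. -/
def SQRTSUM : DecisionProblem where
  Instance := SqrtSumInstance
  Alphabet := Token
  encode := SqrtSumInstance.encode
  encode_injective := SqrtSumInstance.encode_injective
  Yes := SqrtSumInstance.Yes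

/-- The coin-flip measure comparison problem for unambiguous context-free grammars. -/
def UCFGCoinFlipComparison : DecisionProblem where
  Instance := CoinFlipInstance
  Alphabet := Token
  encode := CoinFlipInstance.encode
  encode_injective := CoinFlipInstance.encode_injective
  Yes := CoinFlipInstance.Yes

/-! Over an alphabet with 31 letters every letter weighs 1/32, so disjoint classes of 16, 8, 4 and 2
letters weigh 1/2, 1/4, 1/8 and 1/16. If the right-hand sides of every nonterminal can be told apart
by the first letter, and no symbol derives the empty word, then the grammar is unambiguous, every
symbol generates a prefix-free language, and the weights ∑ (1/32)^|w| satisfy the polynomial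
equations read off the productions (`weight_nonterminal`). Such a grammar is thus an arithmetic
circuit with the four class weights as coefficients. Square roots come from recursion: f = f²/2 + c
means (1 - f)² = 1 - 2c, and f ≤ 1 (`weight_le_one`, from prefix-freeness) selects f = 1 - √(1 -
2c).

Subtraction is not available, so numbers are stored as deviations from constants. The invariant is
that a distinguished nonterminal has the value 1/4 - δ/2^(m+3), where δ = -d₀ + √d₁ + ⋯ is the
partial sum treated so far. A radicand d with ℓ bits enters as the fraction t = d/4^h, where h is
ℓ/2 rounded up; the quadratic equation gives 1 - √d/2^h. One halving and further contractions
towards 1/2 turn this into 1/2 - √d/2^(m+2), and mixing it with the old distinguished value, with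
coefficients 1/4 and 1/2, restores the invariant for δ + √d and m + 1 (`value_buildRoot`). At the
end the measure is 1/128 - δ/(32 · 2^(m+3)), so comparing it with 1/128 compares the sum of the
roots with d₀, the operator being reversed (`yes_reduce`).

The number of nonterminals is at most quadratic in the input length, and each definition after the
initial ones is a bounded number of short productions, so the grammar has polynomial size
(`size_build_le`). A structured program, compiled to a stack machine (`Exec.stepsTo`), writes the
grammar back to front onto the output stack; apart from terms linear in the input, its running time
is charged to the size of what it writes (`runs_program`). -/

/-! ### Structured programs on stacks, and their translation to Turing machines -/

/-- The stacks of the machine. -/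
inductive Stk where
  | inp | out | cur | sidx | tmp | bud | used
  deriving DecidableEq

instance : Fintype Stk where
  elems := {.inp, .out, .cur, .sidx, .tmp, .bud, .used}
  complete k := by cases k <;> simp

/-- The finite control memory of the machine. -/
structure Reg where
  tok : Option Token
  more : Bool
  u : Bool
  v : Bool
  par : Bool
  op : CompOp
  deriving Fintype

/-- The memory of the machine: its control memory and its stacks. -/
structure Store where
  reg : Reg
  inp : List Token
  out : List Token
  cur : List Token
  sidx : List Token
  tmp : List Token
  bud : List Token
  used : List Token

namespace Store

/-- The contents of a stack. -/
def get (s : Store) : Stk → List Token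
  | .inp => s.inp
  | .out => s.out
  | .cur => s.cur
  | .sidx => s.sidx
  | .tmp => s.tmp
  | .bud => s.bud
  | .used => s.used

/-- Replace the contents of a stack. -/
def set (s : Store) (k : Stk) (l : List Token) : Store :=
  match k with
  | .inp => { s with inp := l }
  | .out => { s with out := l }
  | .cur => { s with cur := l }
  | .sidx => { s with sidx := l }
  | .tmp => { s with tmp := l }
  | .bud => { s with bud := l }
  | .used => { s with used := l }

theorem get_set (s : Store) (k : Stk) (l : List Token) :
    (s.set k l).get = Function.update s.get k l := by
  funext j
  cases k <;> cases j <;> rfl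

theorem reg_set (s : Store) (k : Stk) (l : List Token) : (s.set k l).reg = s.reg := by
  cases k <;> rfl

end Store

/-- Elementary instructions. -/
inductive Instr where
  | push (k : Stk) (f : Reg → Token)
  | pop (k : Stk) (f : Reg → Option Token → Reg)
  | load (f : Reg → Reg)

namespace Instr

/-- The effect of an instruction. -/
def apply (s : Store) : Instr → Store
  | .push k f => s.set k (f s.reg :: s.get k)
  | .pop k f => { s.set k (s.get k).tail with reg := f s.reg (s.get k).head? }
  | .load f => { s with reg := f s.reg }

/-- An instruction as part of a statement of a Turing machine. -/
def toStmt {Λ : Type} :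
    Instr → Turing.TM2.Stmt (fun _ : Stk => Token) Λ Reg →
      Turing.TM2.Stmt (fun _ : Stk => Token) Λ Reg
  | .push k f, q => .push k f q
  | .pop k f, q => .pop k f q
  | .load f, q => .load f q

end Instr

/-- Structured programs: blocks of instructions, composition, case distinctions and loops. -/
inductive Prog where
  | basic (is : List Instr)
  | seq (p q : Prog)
  | ite (c : Reg → Bool) (p q : Prog)
  | loop (c : Reg → Bool) (p : Prog)

/-- `Exec p s s' t` : started in `s`, the program `p` ends in `s'` after at most `t` steps. -/
inductive Exec : Prog → Store → Store → ℕ → Prop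
  | basic (is : List Instr) (s : Store) : Exec (.basic is) s (is.foldl Instr.apply s) 1
  | seq {p q : Prog} {s₀ s₁ s₂ : Store} {t₁ t₂ : ℕ} (hp : Exec p s₀ s₁ t₁)
      (hq : Exec q s₁ s₂ t₂) : Exec (.seq p q) s₀ s₂ (t₁ + t₂)
  | iteTrue {c : Reg → Bool} {p q : Prog} {s₀ s₁ : Store} {t : ℕ} (hc : c s₀.reg = true)
      (hp : Exec p s₀ s₁ t) : Exec (.ite c p q) s₀ s₁ (t + 1)
  | iteFalse {c : Reg → Bool} {p q : Prog} {s₀ s₁ : Store} {t : ℕ} (hc : c s₀.reg = false)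
      (hq : Exec q s₀ s₁ t) : Exec (.ite c p q) s₀ s₁ (t + 1)
  | loopFalse {c : Reg → Bool} {p : Prog} {s : Store} (hc : c s.reg = false) :
      Exec (.loop c p) s s 1
  | loopTrue {c : Reg → Bool} {p : Prog} {s₀ s₁ s₂ : Store} {t₁ t₂ : ℕ} (hc : c s₀.reg = true)
      (hp : Exec p s₀ s₁ t₁) (hl : Exec (.loop c p) s₁ s₂ t₂) :
      Exec (.loop c p) s₀ s₂ (t₁ + t₂ + 1)
  | mono {p : Prog} {s₀ s₁ : Store} {t t' : ℕ} (h : Exec p s₀ s₁ t) (ht : t ≤ t') :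
      Exec p s₀ s₁ t'

theorem Exec.basic' {is : List Instr} {s s' : Store} (h : is.foldl Instr.apply s = s') :
    Exec (.basic is) s s' 1 :=
  h ▸ .basic is s

namespace Prog

/-- The program points of a program. -/
def Label : Prog → Type
  | .basic _ => Unit
  | .seq p q => p.Label ⊕ q.Label
  | .ite _ p q => Unit ⊕ (p.Label ⊕ q.Label)
  | .loop _ p => Unit ⊕ p.Label

instance instFintypeLabel : (p : Prog) → Fintype p.Label
  | .basic _ => inferInstanceAs (Fintype Unit)
  | .seq p q =>
    have := instFintypeLabel p
    have := instFintypeLabel q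
    inferInstanceAs (Fintype (p.Label ⊕ q.Label))
  | .ite _ p q =>
    have := instFintypeLabel p
    have := instFintypeLabel q
    inferInstanceAs (Fintype (Unit ⊕ (p.Label ⊕ q.Label)))
  | .loop _ p =>
    have := instFintypeLabel p
    inferInstanceAs (Fintype (Unit ⊕ p.Label))

/-- The program point at which the execution starts. -/
def entry : (p : Prog) → p.Label
  | .basic _ => ()
  | .seq p _ => .inl p.entry
  | .ite _ _ _ => .inl ()
  | .loop _ _ => .inl ()

/-- The statement that continues at a program point, or halts. -/
def exitStmt {Λ : Type} : Option Λ → Turing.TM2.Stmt (fun _ : Stk => Token) Λ Reg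
  | none => .halt
  | some l => .goto fun _ => l

/-- The machine code of a program whose points are embedded by `e` into the labels of a machine,
and which continues at `ex`. -/
def code {Λ : Type} : (p : Prog) → (e : p.Label → Λ) → (ex : Option Λ) → p.Label →
    Turing.TM2.Stmt (fun _ : Stk => Token) Λ Reg
  | .basic is, _, ex, _ => is.foldr Instr.toStmt (exitStmt ex)
  | .seq p q, e, ex, l =>
    match l with
    | .inl l => p.code (fun l => e (.inl l)) (some (e (.inr q.entry))) l
    | .inr l => q.code (fun l => e (.inr l)) ex l
  | .ite c p q, e, ex, l =>
    match l with
    | .inl _ => .branch c (.goto fun _ => e (.inr (.inl p.entry)))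
        (.goto fun _ => e (.inr (.inr q.entry)))
    | .inr (.inl l) => p.code (fun l => e (.inr (.inl l))) ex l
    | .inr (.inr l) => q.code (fun l => e (.inr (.inr l))) ex l
  | .loop c p, e, ex, l =>
    match l with
    | .inl _ => .branch c (.goto fun _ => e (.inr p.entry)) (exitStmt ex)
    | .inr l => p.code (fun l => e (.inr l)) (some (e (.inl ()))) l

theorem stepAux_exitStmt {Λ : Type} (ex : Option Λ) (s : Store) :
    Turing.TM2.stepAux (exitStmt ex) s.reg s.get = ⟨ex, s.reg, s.get⟩ := by
  cases ex <;> rfl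

theorem stepAux_foldr {Λ : Type} (ex : Option Λ) (is : List Instr) (s : Store) :
    Turing.TM2.stepAux (is.foldr Instr.toStmt (exitStmt ex)) s.reg s.get =
      ⟨ex, (is.foldl Instr.apply s).reg, (is.foldl Instr.apply s).get⟩ := by
  induction is generalizing s with
  | nil => exact stepAux_exitStmt ex s
  | cons i is ih =>
    rw [List.foldl_cons, ← ih]
    cases i with
    | push k f =>
      simp only [List.foldr_cons, Instr.toStmt, Instr.apply, Turing.TM2.stepAux, Store.reg_set,
        Store.get_set]
    | pop k f =>
      have : ({ s.set k (s.get k).tail with reg := f s.reg (s.get k).head? } : Store).get =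
          (s.set k (s.get k).tail).get := by
        funext j; cases j <;> rfl
      simp only [List.foldr_cons, Instr.toStmt, Instr.apply, Turing.TM2.stepAux, this,
        Store.get_set]
    | load f =>
      have : ({ s with reg := f s.reg } : Store).get = s.get := by
        funext j; cases j <;> rfl
      simp only [List.foldr_cons, Instr.toStmt, Instr.apply, Turing.TM2.stepAux, this]

end Prog

/-- `n` steps of a machine lead from one configuration to another. -/
abbrev StepsTo {Λ : Type} (M : Λ → Turing.TM2.Stmt (fun _ : Stk => Token) Λ Reg)
    (a b : Turing.TM2.Cfg (fun _ : Stk => Token) Λ Reg) (n : ℕ) : Prop :=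
  (flip bind (Turing.TM2.step M))^[n] (some a) = some b

theorem StepsTo.trans {Λ : Type} {M : Λ → Turing.TM2.Stmt (fun _ : Stk => Token) Λ Reg}
    {a b c : Turing.TM2.Cfg (fun _ : Stk => Token) Λ Reg} {m n : ℕ} (h₁ : StepsTo M a b m)
    (h₂ : StepsTo M b c n) : StepsTo M a c (m + n) := by
  unfold StepsTo at *
  rw [Nat.add_comm, Function.iterate_add_apply, h₁, h₂]

theorem StepsTo.one {Λ : Type} {M : Λ → Turing.TM2.Stmt (fun _ : Stk => Token) Λ Reg} {l : Λ}
    {r : Reg} {S : Stk → List Token} {b : Turing.TM2.Cfg (fun _ : Stk => Token) Λ Reg}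
    (h : Turing.TM2.stepAux (M l) r S = b) : StepsTo M ⟨some l, r, S⟩ b 1 :=
  congrArg some h

/-- The exit point has to vary in the induction: the first part of a composition exits into the
second part, and the body of a loop exits to the loop test instead of halting. -/
theorem Exec.stepsTo {p : Prog} {s s' : Store} {t : ℕ} (h : Exec p s s' t) {Λ : Type}
    (M : Λ → Turing.TM2.Stmt (fun _ : Stk => Token) Λ Reg) (e : p.Label → Λ) (ex : Option Λ)
    (hM : ∀ l, M (e l) = p.code e ex l) :
    ∃ n ≤ t, StepsTo M ⟨some (e p.entry), s.reg, s.get⟩ ⟨ex, s'.reg, s'.get⟩ n := by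
  induction h generalizing ex with
  | basic is s =>
    refine ⟨1, le_rfl, .one ?_⟩
    rw [hM]
    exact Prog.stepAux_foldr ex is s
  | @seq p q s₀ s₁ s₂ t₁ t₂ _ _ ihp ihq =>
    obtain ⟨n₁, h₁, h₁'⟩ := ihp (fun l => e (.inl l)) (some (e (.inr q.entry)))
      fun l => hM (.inl l)
    obtain ⟨n₂, h₂, h₂'⟩ := ihq (fun l => e (.inr l)) ex fun l => hM (.inr l)
    exact ⟨n₁ + n₂, by omega, h₁'.trans h₂'⟩
  | @iteTrue c p q s₀ s₁ t hc _ ih =>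
    obtain ⟨n, h, h'⟩ := ih (fun l => e (.inr (.inl l))) ex fun l => hM (.inr (.inl l))
    refine ⟨1 + n, by omega, StepsTo.trans (.one ?_) h'⟩
    rw [hM]
    simp [Prog.entry, Prog.code, hc]
  | @iteFalse c p q s₀ s₁ t hc _ ih =>
    obtain ⟨n, h, h'⟩ := ih (fun l => e (.inr (.inr l))) ex fun l => hM (.inr (.inr l))
    refine ⟨1 + n, by omega, StepsTo.trans (.one ?_) h'⟩
    rw [hM]
    simp [Prog.entry, Prog.code, hc]
  | @loopFalse c p s hc =>
    refine ⟨1, le_rfl, .one ?_⟩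
    rw [hM]
    simp [Prog.entry, Prog.code, hc, Prog.stepAux_exitStmt]
  | @loopTrue c p s₀ s₁ s₂ t₁ t₂ hc _ _ ihp ihl =>
    obtain ⟨n₁, h₁, h₁'⟩ := ihp (fun l => e (.inr l)) (some (e (.inl ()))) fun l => hM (.inr l)
    obtain ⟨n₂, h₂, h₂'⟩ := ihl e ex hM
    refine ⟨1 + n₁ + n₂, by omega, StepsTo.trans (StepsTo.trans (.one ?_) h₁') h₂'⟩
    rw [hM]
    simp [Prog.entry, Prog.code, hc]
  | mono _ ht ih =>
    obtain ⟨n, h, h'⟩ := ih e ex hM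
    exact ⟨n, h.trans ht, h'⟩

/-- The control memory at the start. -/
def Reg.init : Reg := ⟨none, false, false, false, false, .le⟩

/-- The Turing machine that executes a program. -/
def Prog.machine (p : Prog) : Turing.FinTM2 where
  K := Stk
  k₀ := .inp
  k₁ := .out
  Γ _ := Token
  Λ := p.Label
  main := p.entry
  σ := Reg
  initialState := Reg.init
  m := p.code id none

/-- The memory at the start. -/
def Store.ofInput (l : List Token) : Store := ⟨Reg.init, l, [], [], [], [], [], []⟩

/-- The memory at the end. -/
def Store.ofOutput (l : List Token) : Store := ⟨Reg.init, [], l, [], [], [], [], []⟩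

/-- A function that is computed by a program in polynomial time is computed by a Turing machine in
polynomial time. -/
theorem Prog.computableInPolyTime {α β : Type} {ea : α → List Token} {eb : β → List Token}
    {f : α → β} (p : Prog) (time : Polynomial ℕ)
    (h : ∀ a, Exec p (.ofInput (ea a)) (.ofOutput (eb (f a))) (time.eval (ea a).length)) :
    Nonempty (Turing.TM2ComputableInPolyTime ea eb f) := by
  refine ⟨{ tm := p.machine
            inputAlphabet := Equiv.refl Token
            outputAlphabet := Equiv.refl Token
            time := time
            outputsFun := fun a => ?_ }⟩
  have key := (h a).stepsTo (p.code id none) id none fun _ => rfl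
  have h₁ : ∀ l : List Token, Turing.initList p.machine l =
      ⟨some p.entry, (Store.ofInput l).reg, (Store.ofInput l).get⟩ := by
    intro l
    unfold Turing.initList
    congr 1
    funext k
    cases k <;> rfl
  have h₂ : ∀ l : List Token, Turing.haltList p.machine l =
      ⟨none, (Store.ofOutput l).reg, (Store.ofOutput l).get⟩ := by
    intro l
    unfold Turing.haltList
    congr 1
    funext k
    cases k <;> rfl
  -- Both alphabets are identified by the identity, so words appear mapped along it.
  have e₁ := (congrArg (Turing.initList p.machine) (List.map_id (ea a))).trans (h₁ (ea a))
  have e₂ := (congrArg (Turing.haltList p.machine) (List.map_id (eb (f a)))).trans (h₂ (eb (f a)))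
  exact
    { steps := key.choose
      evals_in_steps :=
        (congrArg (fun c => (flip bind p.machine.step)^[key.choose] (some c)) e₁).trans
          (Eq.trans key.choose_spec.2 (congrArg some e₂.symm))
      steps_le_m := key.choose_spec.1 }


/-! ### From grammars to polynomial equations for weights. -/

/-! ### The weight of a language -/

/-- The weight `∑_{w ∈ L} r ^ |w|` of a language. -/
noncomputable def Language.weight {T : Type} (r : ENNReal) (L : Language T) : ENNReal :=
  ∑' w : {w : List T // w ∈ L}, r ^ w.val.length

/-- No word of the language is a proper prefix of another one. -/
def Language.PrefixFree {T : Type} (L : Language T) : Prop :=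
  ∀ u ∈ L, ∀ v ∈ L, ∀ s t : List T, u ++ s = v ++ t → u = v

namespace Language

variable {T : Type} (r : ENNReal)

theorem weight_mono {L M : Language T} (h : ∀ w ∈ L, w ∈ M) : L.weight r ≤ M.weight r := by
  unfold weight
  exact ENNReal.tsum_comp_le_tsum_of_injective
    (f := fun w : {w : List T // w ∈ L} => (⟨w.1, h _ w.2⟩ : {w : List T // w ∈ M}))
    (fun a b hab => by simpa [Subtype.ext_iff] using hab)
    (fun w : {w : List T // w ∈ M} => r ^ w.val.length)

theorem weight_zero : (0 : Language T).weight r = 0 := by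
  have : IsEmpty {w : List T // w ∈ (0 : Language T)} := ⟨fun w => Language.notMem_zero _ w.2⟩
  simp [weight]

theorem weight_singleton (w : List T) : ({w} : Language T).weight r = r ^ w.length := by
  have : ({w} : Language T).weight r = ∑' v : ({w} : Set (List T)), r ^ v.val.length := rfl
  rw [this, tsum_singleton w fun v : List T => r ^ v.length]

theorem weight_one : (1 : Language T).weight r = 1 :=
  (weight_singleton r []).trans (by simp)

theorem weight_add {L M : Language T} (h : ∀ w ∈ L, w ∉ M) :
    (L + M).weight r = L.weight r + M.weight r := by
  have hd : Disjoint (L : Set (List T)) M := Set.disjoint_left.2 h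
  exact ENNReal.summable.tsum_union_disjoint (f := fun w : List T => r ^ w.length) hd
    ENNReal.summable

/-- Prefix-freeness of the left factor makes the splitting of a word of `L * M` unique, so
concatenation is a bijection from pairs of words. -/
theorem weight_mul {L M : Language T} (h : L.PrefixFree) :
    (L * M).weight r = L.weight r * M.weight r := by
  let F : {w : List T // w ∈ L} × {w : List T // w ∈ M} → {w : List T // w ∈ L * M} :=
    fun p => ⟨p.1.1 ++ p.2.1, Language.append_mem_mul p.1.2 p.2.2⟩
  have hF : Function.Bijective F := by
    constructor
    · rintro ⟨⟨u, hu⟩, v, hv⟩ ⟨⟨u', hu'⟩, v', hv'⟩ huv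
      have huv' : u ++ v = u' ++ v' := congrArg Subtype.val huv
      obtain rfl := h u hu u' hu' _ _ huv'
      obtain rfl := List.append_cancel_left huv'
      rfl
    · rintro ⟨w, hw⟩
      obtain ⟨u, hu, v, hv, rfl⟩ := Language.mem_mul.1 hw
      exact ⟨(⟨u, hu⟩, ⟨v, hv⟩), rfl⟩
  unfold weight
  rw [← (Equiv.ofBijective F hF).tsum_eq, ENNReal.tsum_prod', ← ENNReal.tsum_mul_right]
  refine tsum_congr fun u => ?_
  rw [← ENNReal.tsum_mul_left]
  refine tsum_congr fun v => ?_
  simp [F, pow_add]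

theorem weight_pow {L : Language T} (h : L.PrefixFree) (n : ℕ) :
    (L ^ n).weight r = L.weight r ^ n := by
  induction n with
  | zero => simpa using weight_one r
  | succ n ih => rw [pow_succ', weight_mul r h, ih, pow_succ']

/-- The weight of a prefix-free language is at most `1` whenever the weight of the language of all
words is finite. -/
theorem weight_le_one {L : Language T} (h : L.PrefixFree)
    (hr : (⊤ : Language T).weight r ≠ ⊤) : L.weight r ≤ 1 := by
  by_contra! hL
  -- All powers of `L` lie in the language of all words, so the powers of its weight stay below a
  -- finite bound; this excludes a weight above 1.
  have hb : ∀ n : ℕ, L.weight r ^ n ≤ (⊤ : Language T).weight r := fun n =>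
    (weight_pow r h n).symm.le.trans (weight_mono r fun _ _ => trivial)
  have hfin : L.weight r ≠ ⊤ := ne_top_of_le_ne_top hr (by simpa using hb 1)
  obtain ⟨n, hn⟩ := pow_unbounded_of_one_lt ((⊤ : Language T).weight r).toReal
    ((ENNReal.toReal_lt_toReal ENNReal.one_ne_top hfin).2 hL)
  have := ENNReal.toReal_mono hr (hb n)
  rw [ENNReal.toReal_pow] at this
  linarith

/-- The terms of the coin-flip series carry just one more constant factor, so its convergence
suffices. -/
theorem weight_top_ne_top [Fintype T] :
    (⊤ : Language T).weight (ENNReal.ofReal (1 / ((Fintype.card T : ℝ) + 1))) ≠ ⊤ := by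
  set x : ℝ := 1 / ((Fintype.card T : ℝ) + 1) with hx
  have hx0 : 0 < x := by positivity
  have h : Summable fun w : {w : List T // w ∈ (⊤ : Language T)} => x ^ w.val.length := by
    have := (summable_coinFlipMeasure (⊤ : Language T)).mul_left x⁻¹
    refine this.congr fun w => ?_
    rw [← hx, pow_succ']
    field_simp
  have := h.tsum_ofReal_ne_top
  simpa [weight, ENNReal.ofReal_pow hx0.le] using this

theorem coinFlipMeasure_eq_weight [Fintype T] (L : Language T) :
    coinFlipMeasure L = 1 / ((Fintype.card T : ℝ) + 1) *
      (L.weight (ENNReal.ofReal (1 / ((Fintype.card T : ℝ) + 1)))).toReal := by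
  unfold coinFlipMeasure weight
  have hx : 0 ≤ 1 / ((Fintype.card T : ℝ) + 1) := by positivity
  rw [ENNReal.tsum_toReal_eq fun w => ENNReal.pow_ne_top ENNReal.ofReal_ne_top, ← tsum_mul_left]
  refine tsum_congr fun w => ?_
  rw [ENNReal.toReal_pow, ENNReal.toReal_ofReal hx, pow_succ']

end Language

/-! ### The languages generated by the symbols of a grammar -/

namespace ContextFreeGrammar

variable {T : Type} (g : ContextFreeGrammar T)

/-- The words that have a derivation tree with a given root. -/
def symbolLanguage (s : Symbol T g.NT) : Language T :=
  {w | ∃ t : DerivTree T g.NT, t.Valid g ∧ t.root = s ∧ t.yield = w}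

theorem language_eq_symbolLanguage : g.language = g.symbolLanguage (.nonterminal g.initial) := by
  ext w
  exact g.mem_language_iff_exists_derivTree w

theorem mem_prod_symbolLanguage (α : List (Symbol T g.NT)) (w : List T) :
    w ∈ (α.map g.symbolLanguage).prod ↔ ∃ ts : List (DerivTree T g.NT),
      ts.map DerivTree.root = α ∧ (∀ t ∈ ts, t.Valid g) ∧ ts.flatMap DerivTree.yield = w := by
  induction α generalizing w with
  | nil => simp [Language.mem_one, eq_comm]
  | cons s α ih =>
    rw [List.map_cons, List.prod_cons, Language.mem_mul]
    constructor
    · rintro ⟨u, ⟨t, ht, rfl, rfl⟩, v, hv, rfl⟩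
      obtain ⟨ts, rfl, hts, rfl⟩ := (ih v).1 hv
      exact ⟨t :: ts, by simp, by simpa using ⟨ht, hts⟩, by simp⟩
    · rintro ⟨ts, hts, hv, rfl⟩
      obtain ⟨t, ts, rfl, rfl, rfl⟩ := List.map_eq_cons_iff.1 hts
      simp only [List.mem_cons, forall_eq_or_imp] at hv
      exact ⟨t.yield, ⟨t, hv.1, rfl, rfl⟩, ts.flatMap DerivTree.yield,
        (ih _).2 ⟨ts, rfl, hv.2, rfl⟩, by simp⟩

theorem symbolLanguage_terminal (a : T) : g.symbolLanguage (.terminal a) = {[a]} := by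
  ext w
  constructor
  · rintro ⟨t, ht, hr, rfl⟩
    cases t with
    | leaf b =>
      obtain rfl : b = a := by simpa [DerivTree.root] using hr
      simp [DerivTree.yield]
      rfl
    | node X ts => simp [DerivTree.root] at hr
  · rintro rfl
    exact ⟨.leaf a, .leaf a, rfl, by simp [DerivTree.yield]⟩

theorem mem_symbolLanguage_nonterminal (X : g.NT) (w : List T) :
    w ∈ g.symbolLanguage (.nonterminal X) ↔
      ∃ α, (⟨X, α⟩ : ContextFreeRule T g.NT) ∈ g.rules ∧ w ∈ (α.map g.symbolLanguage).prod := by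
  simp only [mem_prod_symbolLanguage]
  constructor
  · rintro ⟨t, ht, hr, rfl⟩
    cases ht with
    | leaf a => simp [DerivTree.root] at hr
    | node Y ts hrule hts =>
      obtain rfl : Y = X := by simpa [DerivTree.root] using hr
      exact ⟨_, hrule, ts, rfl, hts, by simp [DerivTree.yield]⟩
  · rintro ⟨α, hα, ts, rfl, hts, rfl⟩
    exact ⟨.node X ts, .node X ts hα hts, rfl, by simp [DerivTree.yield]⟩

/-- Data showing that the productions of a grammar can be told apart by the first letter of the
words derived from them, and that the empty word is not derived. -/
structure Predictive where
  /-- the letters with which the words derived from a symbol may start -/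
  first : Symbol T g.NT → Set T
  first_terminal (a : T) : first (.terminal a) = {a}
  /-- the right-hand sides for a nonterminal -/
  body : g.NT → List (List (Symbol T g.NT))
  mem_rules (X : g.NT) (α : List (Symbol T g.NT)) :
    (⟨X, α⟩ : ContextFreeRule T g.NT) ∈ g.rules ↔ α ∈ body X
  head (X : g.NT) : ∀ α ∈ body X, ∃ s β, α = s :: β ∧ first s ⊆ first (.nonterminal X)
  pairwise (X : g.NT) : (body X).Pairwise fun α β =>
    ∀ s ∈ α.head?, ∀ s' ∈ β.head?, Disjoint (first s) (first s')

namespace Predictive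

variable {g} (P : g.Predictive)
include P

/-- The condition `head` passes the possible first letters down the leftmost branch of the tree; in
particular no yield is empty. -/
theorem exists_yield_eq_cons {t : DerivTree T g.NT} (h : t.Valid g) :
    ∃ a ∈ P.first t.root, ∃ l, t.yield = a :: l := by
  induction h with
  | leaf a => exact ⟨a, by simp [DerivTree.root, P.first_terminal], [], by simp [DerivTree.yield]⟩
  | node X ts hrule hts ih =>
    obtain ⟨s, β, hs, hsub⟩ := P.head X _ ((P.mem_rules X _).1 hrule)
    obtain ⟨t, ts, rfl, rfl, rfl⟩ := List.map_eq_cons_iff.1 hs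
    obtain ⟨a, ha, l, hl⟩ := ih t (by simp)
    exact ⟨a, hsub ha, l ++ ts.flatMap DerivTree.yield, by simp [DerivTree.yield, hl]⟩

theorem exists_flatMap_yield_eq_cons {X : g.NT} {ts : List (DerivTree T g.NT)}
    (hX : ts.map DerivTree.root ∈ P.body X) (hts : ∀ t ∈ ts, t.Valid g) :
    ∃ s ∈ (ts.map DerivTree.root).head?, ∃ a ∈ P.first s, ∃ l,
      ts.flatMap DerivTree.yield = a :: l := by
  obtain ⟨s, β, hs, -⟩ := P.head X _ hX
  obtain ⟨t, ts, rfl, rfl, rfl⟩ := List.map_eq_cons_iff.1 hs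
  obtain ⟨a, ha, l, hl⟩ := P.exists_yield_eq_cons (hts t (by simp))
  exact ⟨t.root, by simp, a, ha, l ++ ts.flatMap DerivTree.yield, by simp [hl]⟩

/-- Two yields with a common continuation share their first letter, which determines the production
at the root; the children are then compared from left to right, cancelling one yield at a time. The
tails `u` and `u'` absorb the siblings still to come. Empty tails give unambiguity, arbitrary tails
give prefix-freeness. -/
theorem eq_of_yield_append {t : DerivTree T g.NT} (h : t.Valid g) :
    ∀ t' : DerivTree T g.NT, t'.Valid g → t.root = t'.root →
      ∀ u u' : List T, t.yield ++ u = t'.yield ++ u' → t = t' := by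
  induction h with
  | leaf a =>
    rintro (b | ⟨Y, ts'⟩) - hr
    · intro _ _ _
      simpa [DerivTree.root] using hr
    · simp [DerivTree.root] at hr
  | node X ts hrule hts ih =>
    intro t' ht' hr u u' hu
    cases ht' with
    | leaf b => simp [DerivTree.root] at hr
    | node Y ts' hrule' hts' =>
      obtain rfl : X = Y := by simpa [DerivTree.root] using hr
      simp only [DerivTree.yield] at hu
      have hb := (P.mem_rules X _).1 hrule
      have hb' := (P.mem_rules X _).1 hrule'
      have hroots : ts.map DerivTree.root = ts'.map DerivTree.root := by
        by_contra hne
        -- Disjointness is symmetric, so the pairwise condition applies to any two distinct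
        -- right-hand sides, whatever their order in the list.
        have : Std.Symm fun α β : List (Symbol T g.NT) =>
            ∀ s ∈ α.head?, ∀ s' ∈ β.head?, Disjoint (P.first s) (P.first s') :=
          ⟨fun α β h s hs s' hs' => (h s' hs' s hs).symm⟩
        have hd := (P.pairwise X).forall hb hb' hne
        obtain ⟨s, hs, a, ha, l, hl⟩ := P.exists_flatMap_yield_eq_cons hb hts
        obtain ⟨s', hs', a', ha', l', hl'⟩ := P.exists_flatMap_yield_eq_cons hb' hts'
        rw [hl, hl', List.cons_append, List.cons_append, List.cons.injEq] at hu
        exact Set.disjoint_left.1 (hd s hs s' hs') ha (hu.1 ▸ ha')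
      have key : ∀ l l' : List (DerivTree T g.NT), (∀ t ∈ l, t ∈ ts) → (∀ t ∈ l', t ∈ ts') →
          l.map DerivTree.root = l'.map DerivTree.root → ∀ u u' : List T,
          l.flatMap DerivTree.yield ++ u = l'.flatMap DerivTree.yield ++ u' → l = l' := by
        intro l
        induction l with
        | nil =>
          rintro (_ | ⟨t', l'⟩) - - h
          · intro _ _ _; rfl
          · simp at h
        | cons t l ihl =>
          rintro (_ | ⟨t', l'⟩) hl hl' h u u' huu
          · simp at h
          · simp only [List.map_cons, List.cons.injEq] at h
            simp only [List.flatMap_cons, List.append_assoc] at huu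
            obtain rfl := ih t (hl t (by simp)) t' (hts' t' (hl' t' (by simp))) h.1 _ _ huu
            rw [ihl l' (fun t ht => hl t (by simp [ht])) (fun t ht => hl' t (by simp [ht])) h.2
              u u' (List.append_cancel_left huu)]
      rw [key ts ts' (fun _ h => h) (fun _ h => h) hroots u u' hu]

theorem unambiguous : g.Unambiguous := by
  intro w hw
  obtain ⟨t, ht⟩ := (g.mem_language_iff_exists_derivTree w).1 hw
  refine ⟨t, ht, fun t' ht' => ?_⟩
  exact P.eq_of_yield_append ht'.1 t ht.1 (ht'.2.1.trans ht.2.1.symm) [] []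
    (by rw [ht.2.2, ht'.2.2])

theorem prefixFree (s : Symbol T g.NT) : (g.symbolLanguage s).PrefixFree := by
  rintro _ ⟨t, ht, rfl, rfl⟩ _ ⟨t', ht', hr, rfl⟩ u u' h
  rw [P.eq_of_yield_append ht t' ht' hr.symm u u' h]

theorem weight_prod (r : ENNReal) (α : List (Symbol T g.NT)) :
    ((α.map g.symbolLanguage).prod).weight r =
      (α.map fun s => (g.symbolLanguage s).weight r).prod := by
  induction α with
  | nil => simpa using Language.weight_one r
  | cons s α ih => simp [Language.weight_mul r (P.prefixFree s), ih]

/-- The weight equations of a grammar. -/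
theorem weight_nonterminal (r : ENNReal) (X : g.NT) :
    (g.symbolLanguage (.nonterminal X)).weight r =
      ((P.body X).map fun α => (α.map fun s => (g.symbolLanguage s).weight r).prod).sum := by
  have hX : g.symbolLanguage (.nonterminal X) =
      ((P.body X).map fun α => (α.map g.symbolLanguage).prod).sum := by
    have hsum : ∀ (l : List (Language T)) (w : List T), w ∈ l.sum ↔ ∃ L ∈ l, w ∈ L := by
      intro l w
      induction l with
      | nil => simp [Language.notMem_zero]
      | cons L l ih => simp [Language.mem_add, ih]
    ext w
    rw [hsum]
    simp [mem_symbolLanguage_nonterminal, P.mem_rules]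
  rw [hX]
  -- Disjoint sets of first letters make the languages of different right-hand sides disjoint, so
  -- their weights add; prefix-freeness turns each product of languages into a product of weights.
  have key : ∀ l : List (List (Symbol T g.NT)), (∀ α ∈ l, α ∈ P.body X) →
      (l.Pairwise fun α β => ∀ s ∈ α.head?, ∀ s' ∈ β.head?, Disjoint (P.first s) (P.first s')) →
      Language.weight r ((l.map fun α => (α.map g.symbolLanguage).prod).sum) =
        (l.map fun α => (α.map fun s => (g.symbolLanguage s).weight r).prod).sum := by
    intro l
    induction l with
    | nil => intro _ _; simpa using Language.weight_zero r
    | cons α l ih =>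
      intro hl hp
      rw [List.pairwise_cons] at hp
      simp only [List.map_cons, List.sum_cons]
      rw [Language.weight_add, ih (fun α h => hl α (by simp [h])) hp.2, P.weight_prod]
      intro w hw hw'
      have : ∃ β ∈ l, w ∈ (β.map g.symbolLanguage).prod := by
        clear ih hl hp
        induction l with
        | nil => exact absurd hw' (Language.notMem_zero w)
        | cons β l ihl =>
          rcases hw' with hw' | hw'
          · exact ⟨β, by simp, hw'⟩
          · obtain ⟨γ, h1, h2⟩ := ihl hw'
            exact ⟨γ, by simp [h1], h2⟩
      obtain ⟨β, hβ, hwβ⟩ := this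
      obtain ⟨ts, rfl, hts, rfl⟩ := (g.mem_prod_symbolLanguage _ _).1 hw
      obtain ⟨ts', rfl, hts', heq⟩ := (g.mem_prod_symbolLanguage _ _).1 hwβ
      obtain ⟨s, hs, a, ha, u, hu⟩ := P.exists_flatMap_yield_eq_cons (hl _ (by simp)) hts
      obtain ⟨s', hs', a', ha', u', hu'⟩ :=
        P.exists_flatMap_yield_eq_cons (hl _ (by simp [hβ])) hts'
      rw [hu, hu', List.cons.injEq] at heq
      exact Set.disjoint_left.1 (hp.1 _ hβ s hs s' hs') ha (heq.1 ▸ ha')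
  exact key _ (fun _ h => h) (P.pairwise X)

end Predictive

end ContextFreeGrammar


/-! ### Numbered grammars over 31 letters and the equations for their values. -/

/-! ### Grammars given by a growing list of definitions -/

/-- The right-hand sides for one nonterminal; nonterminals are numbered. -/
abbrev Body := List (List (Symbol (Fin 31) ℕ))

/-- The right-hand sides for a nonterminal; the most recent definition comes first, and a
nonterminal is numbered by the number of definitions that precede its own. -/
def lookupBody : List Body → ℕ → Body
  | [], _ => []
  | b :: B, i => if i = B.length then b else lookupBody B i

/-- Read the number of a nonterminal modulo `k`. -/
def toFinSymbol (k : ℕ) [NeZero k] : Symbol (Fin 31) ℕ → Symbol (Fin 31) (Fin k)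
  | .terminal a => .terminal a
  | .nonterminal i => .nonterminal (Fin.ofNat k i)

/-- The productions of a list of definitions. -/
def productions (k : ℕ) [NeZero k] : List Body → List (ContextFreeRule (Fin 31) (Fin k))
  | [] => []
  | b :: B => b.map (fun α => ⟨Fin.ofNat k B.length, α.map (toFinSymbol k)⟩) ++ productions k B

/-- The grammar given by a list of definitions. -/
def presentationOf (B : List Body) (s : ℕ) (hs : s < B.length) : CFGPresentation where
  n := 31
  k := B.length
  start := ⟨s, hs⟩
  rules := haveI : NeZero B.length := ⟨by omega⟩; productions B.length B

/-- Numbers below `B.length` are unchanged by reduction modulo `k`, so different definitions keep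
different left-hand sides. -/
theorem mem_productions {k : ℕ} [NeZero k] {B : List Body} (hB : B.length ≤ k) (X : Fin k)
    (α : List (Symbol (Fin 31) (Fin k))) :
    (⟨X, α⟩ : ContextFreeRule (Fin 31) (Fin k)) ∈ productions k B ↔
      ∃ β ∈ lookupBody B X, β.map (toFinSymbol k) = α := by
  induction B with
  | nil => simp [productions, lookupBody]
  | cons b B ih =>
    simp only [List.length_cons] at hB
    have hmod : B.length % k = B.length := Nat.mod_eq_of_lt (by omega)
    have ih := ih (by omega)
    simp only [productions, List.mem_append, List.mem_map, ContextFreeRule.mk.injEq, lookupBody]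
    by_cases hX : (X : ℕ) = B.length
    · rw [if_pos hX]
      -- A number that is not yet defined has no right-hand sides, so the older definitions
      -- contribute nothing to the newest nonterminal.
      have hno : ¬ (⟨X, α⟩ : ContextFreeRule (Fin 31) (Fin k)) ∈ productions k B := by
        rw [ih, hX]
        have : ∀ (C : List Body) (i : ℕ), C.length ≤ i → lookupBody C i = [] := by
          intro C
          induction C with
          | nil => intro i _; rfl
          | cons c C ihC =>
            intro i hi
            simp only [List.length_cons] at hi
            rw [lookupBody, if_neg (by omega), ihC i (by omega)]
        simp [this B B.length le_rfl]
      simp only [hno, or_false]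
      constructor
      · rintro ⟨β, h1, -, h2⟩
        exact ⟨β, h1, h2⟩
      · rintro ⟨β, h1, h2⟩
        exact ⟨β, h1, Fin.ext (by simp [Fin.ofNat, hmod, hX]), h2⟩
    · rw [if_neg hX, ← ih]
      constructor
      · rintro (⟨β, -, h, -⟩ | h)
        · exact absurd (by rw [← h]; simp [Fin.ofNat, hmod]) hX
        · exact h
      · exact .inr

/-! ### Classes of letters -/

/-- The first `16`, the next `8`, the next `4`, and the next `2` letters form four classes. -/
def letterClass (a : Fin 31) : ℕ :=
  if (a : ℕ) < 16 then 0 else if (a : ℕ) < 24 then 1 else if (a : ℕ) < 28 then 2 else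
    if (a : ℕ) < 30 then 3 else 4

/-- The productions for the nonterminal of a class of letters. -/
def classBody (i : ℕ) : Body :=
  ((List.finRange 31).filter fun a => letterClass a = i).map fun a => [.terminal a]

/-- The letters with which the words derived from a symbol may start. -/
def firstLetters : Symbol (Fin 31) ℕ → Set (Fin 31)
  | .terminal a => {a}
  | .nonterminal i => if i < 4 then {a | letterClass a = i} else Set.univ

/-- The conditions on the right-hand sides for the nonterminal with number `c`. -/
structure Body.Good (c : ℕ) (b : Body) : Prop where
  head : ∀ α ∈ b, ∃ s β, α = s :: β ∧ firstLetters s ⊆ firstLetters (.nonterminal c)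
  pairwise : b.Pairwise fun α β =>
    ∀ s ∈ α.head?, ∀ s' ∈ β.head?, Disjoint (firstLetters s) (firstLetters s')
  index_le : ∀ α ∈ b, ∀ i, Symbol.nonterminal i ∈ α → i ≤ c

/-- All definitions of the list are good. -/
def GoodBodies : List Body → Prop
  | [] => True
  | b :: B => Body.Good B.length b ∧ GoodBodies B

theorem GoodBodies.lookup {B : List Body} (h : GoodBodies B) {i : ℕ} (hi : i < B.length) :
    Body.Good i (lookupBody B i) := by
  induction B with
  | nil => simp at hi
  | cons b B ih =>
    rw [lookupBody]
    split_ifs with hib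
    · rw [hib]; exact h.1
    · exact ih h.2 (by simp only [List.length_cons] at hi; omega)

/-- Forget the bound on the number of a nonterminal. -/
def ofFinSymbol {k : ℕ} : Symbol (Fin 31) (Fin k) → Symbol (Fin 31) ℕ
  | .terminal a => .terminal a
  | .nonterminal i => .nonterminal i

theorem ofFinSymbol_toFinSymbol {k : ℕ} [NeZero k] (s : Symbol (Fin 31) ℕ)
    (h : ∀ i, s = .nonterminal i → i < k) : ofFinSymbol (toFinSymbol k s) = s := by
  cases s with
  | terminal a => rfl
  | nonterminal i => simp [toFinSymbol, ofFinSymbol, Fin.ofNat, Nat.mod_eq_of_lt (h i rfl)]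

/-- The grammar given by a list of definitions, with `k` nonterminals. -/
abbrev grammarOf (k : ℕ) [NeZero k] (start : Fin k) (B : List Body) :
    ContextFreeGrammar (Fin 31) where
  NT := Fin k
  initial := start
  rules := (productions k B).toFinset

/-- The productions of a list of good definitions can be told apart by first letters. -/
def predictiveOf {k : ℕ} [NeZero k] {start : Fin k} {B : List Body} (hB : GoodBodies B)
    (hk : B.length = k) : (grammarOf k start B).Predictive :=
  have hlt : ∀ X : Fin k, (X : ℕ) < B.length := fun X => hk ▸ X.2
  have hof : ∀ X : Fin k, ∀ α ∈ lookupBody B X, ∀ σ ∈ α,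
      ofFinSymbol (toFinSymbol k σ) = σ := fun X α hα σ hσ =>
    ofFinSymbol_toFinSymbol σ fun i hi =>
      ((hB.lookup (hlt X)).index_le α hα i (hi ▸ hσ)).trans_lt X.2
  { first := fun σ => firstLetters (ofFinSymbol σ)
    first_terminal := fun _ => rfl
    body := fun X => (lookupBody B X).map (List.map (toFinSymbol k))
    mem_rules := fun X α => by
      rw [List.mem_toFinset, mem_productions hk.le, List.mem_map]
    head := fun X α hα => by
      obtain ⟨β, hβ, rfl⟩ := List.mem_map.1 hα
      obtain ⟨σ, γ, rfl, hσ⟩ := (hB.lookup (hlt X)).head β hβ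
      refine ⟨_, _, List.map_cons, ?_⟩
      rw [hof X _ hβ σ (by simp)]
      exact hσ
    pairwise := fun X => by
      rw [List.pairwise_map]
      refine (hB.lookup (hlt X)).pairwise.imp_of_mem fun {α β} hα hβ h => ?_
      rintro σ hσ σ' hσ'
      rw [List.head?_map, Option.mem_def, Option.map_eq_some_iff] at hσ hσ'
      obtain ⟨τ, hτ, rfl⟩ := hσ
      obtain ⟨τ', hτ', rfl⟩ := hσ'
      rw [hof X α hα τ (List.mem_of_mem_head? hτ), hof X β hβ τ' (List.mem_of_mem_head? hτ')]
      exact h τ hτ τ' hτ' }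

/-! ### The weight equations -/

/-- The value of a symbol, given the values of the nonterminals. -/
noncomputable def symbolValue (val : ℕ → ℝ) : Symbol (Fin 31) ℕ → ℝ
  | .terminal _ => 1 / 32
  | .nonterminal i => val i

/-- The value of a definition, given the values of the nonterminals. -/
noncomputable def Body.value (val : ℕ → ℝ) (b : Body) : ℝ :=
  (b.map fun α => (α.map (symbolValue val)).prod).sum

/-- The values of the nonterminals satisfy the equations given by their definitions. -/
def Solves (val : ℕ → ℝ) : List Body → Prop
  | [] => True
  | b :: B => val B.length = b.value val ∧ Solves val B

theorem solves_of_lookup {val : ℕ → ℝ} {B : List Body}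
    (h : ∀ i < B.length, val i = (lookupBody B i).value val) : Solves val B := by
  induction B with
  | nil => trivial
  | cons b B ih =>
    refine ⟨?_, ih fun i hi => ?_⟩
    · rw [h B.length (by simp), lookupBody, if_pos rfl]
    · rw [h i (by simp only [List.length_cons]; omega), lookupBody, if_neg (by omega)]

/-- The coin-flip measure of a grammar that is given by good definitions. -/
theorem exists_value_grammarOf {k : ℕ} [NeZero k] {s : ℕ} (hs : s < k) {B : List Body}
    (hB : GoodBodies B) (hk : B.length = k) : ∃ val : ℕ → ℝ, Solves val B ∧ (∀ i, val i ≤ 1) ∧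
      coinFlipMeasure (grammarOf k ⟨s, hs⟩ B).language = 1 / 32 * val s := by
  let P := predictiveOf (start := ⟨s, hs⟩) hB hk
  set r : ENNReal := ENNReal.ofReal (1 / ((Fintype.card (Fin 31) : ℝ) + 1)) with hr
  have hr' : r.toReal = 1 / 32 := by
    rw [hr, ENNReal.toReal_ofReal (by positivity)]
    norm_num
  obtain ⟨W, hW⟩ : ∃ W : Symbol (Fin 31) (Fin k) → ENNReal,
      W = fun σ => ((grammarOf k ⟨s, hs⟩ B).symbolLanguage σ).weight r := ⟨_, rfl⟩
  have hle : ∀ σ, W σ ≤ 1 := fun σ => by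
    rw [hW]
    exact Language.weight_le_one r (P.prefixFree σ) Language.weight_top_ne_top
  have hfin : ∀ σ, W σ ≠ ⊤ := fun σ => ne_top_of_le_ne_top ENNReal.one_ne_top (hle σ)
  -- Since the index is read modulo `k`, the bound by 1 holds for all natural numbers.
  let val : ℕ → ℝ := fun i => (W (.nonterminal (Fin.ofNat k i))).toReal
  have hsym : ∀ σ, (W (toFinSymbol k σ)).toReal = symbolValue val σ := by
    rintro (a | i)
    · have h1 : W (.terminal a) = r := by
        rw [hW]
        exact (congrArg (Language.weight r)
          ((grammarOf k ⟨s, hs⟩ B).symbolLanguage_terminal a)).trans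
            ((Language.weight_singleton r [a]).trans (pow_one r))
      rw [toFinSymbol, h1, hr', symbolValue]
    · rfl
  have hprod : ∀ α : List (Symbol (Fin 31) ℕ),
      ((α.map (toFinSymbol k)).map W).prod ≠ ⊤ ∧
      (((α.map (toFinSymbol k)).map W).prod).toReal = (α.map (symbolValue val)).prod := by
    intro α
    induction α with
    | nil => simp
    | cons σ α ih =>
      simp only [List.map_cons, List.prod_cons, ENNReal.toReal_mul, ih.2, hsym, and_true]
      exact ENNReal.mul_ne_top (hfin _) ih.1
  -- Finiteness is proved alongside, because `ENNReal.toReal` respects sums only of finite terms.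
  have hsum : ∀ b : Body,
      ((b.map (List.map (toFinSymbol k))).map fun α => (α.map W).prod).sum ≠ ⊤ ∧
      ENNReal.toReal ((b.map (List.map (toFinSymbol k))).map fun α => (α.map W).prod).sum =
        b.value val := by
    intro b
    induction b with
    | nil => simp [Body.value]
    | cons α b ih =>
      have h := hprod α
      simp only [Body.value, List.map_cons, List.sum_cons] at ih ⊢
      exact ⟨ENNReal.add_ne_top.2 ⟨h.1, ih.1⟩, by
        rw [ENNReal.toReal_add h.1 ih.1, h.2, ih.2]⟩
  refine ⟨val, solves_of_lookup fun i hi => ?_, fun i => ?_, ?_⟩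
  · have hX : W (.nonterminal (Fin.ofNat k i)) =
        ((P.body (Fin.ofNat k i)).map fun α => (α.map W).prod).sum := by
      rw [hW]
      exact P.weight_nonterminal r (Fin.ofNat k i)
    have hbody : P.body (Fin.ofNat k i) = (lookupBody B i).map (List.map (toFinSymbol k)) := by
      change (lookupBody B (Fin.ofNat k i : Fin k)).map _ = _
      rw [Fin.val_ofNat, Nat.mod_eq_of_lt (hk ▸ hi)]
    rw [hbody] at hX
    rw [← (hsum _).2, ← hX]
  · exact ENNReal.toReal_le_of_le_ofReal zero_le_one (by simpa using hle _)
  · have hstart : (⟨s, hs⟩ : Fin k) = Fin.ofNat k s :=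
      Fin.ext (by rw [Fin.val_ofNat, Nat.mod_eq_of_lt hs])
    rw [Language.coinFlipMeasure_eq_weight, ContextFreeGrammar.language_eq_symbolLanguage]
    have h32 : 1 / ((Fintype.card (Fin 31) : ℝ) + 1) = 1 / 32 := by norm_num
    simp only [val, ← hstart, hW, hr, h32]


/-! ### Arithmetic by productions: halving, mixing and square roots. -/

/-! ### Templates of definitions -/

/-- References to nonterminals: to a class of letters, to the nonterminal that is being defined,
to the one before it, or to a distinguished one. -/
inductive Ref where
  | cls (i : Fin 4)
  | self
  | prev
  | mark

/-- The number of a nonterminal, if the one that is being defined has the number `c` and the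
distinguished one has the number `s`. -/
def Ref.index (c s : ℕ) : Ref → ℕ
  | .cls i => i
  | .self => c
  | .prev => c - 1
  | .mark => s

/-- The right-hand sides of a nonterminal, given by references. -/
abbrev Template := List (List Ref)

/-- The definition given by a template. -/
def Template.inst (τ : Template) (c s : ℕ) : Body :=
  τ.map fun α => α.map fun ρ => .nonterminal (ρ.index c s)

/-- Add a definition. -/
def extend (τ : Template) (s : ℕ) (B : List Body) : List Body :=
  τ.inst B.length s :: B

/-- A few short right-hand sides that start with different classes of letters. -/
structure Template.Good (τ : Template) : Prop where
  head : ∀ α ∈ τ, ∃ i, α.head? = some (.cls i)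
  pairwise : τ.Pairwise fun α β => α.head? ≠ β.head?
  length_le : τ.length ≤ 4
  length_le_of_mem : ∀ α ∈ τ, α.length ≤ 3

/-- Each right-hand side starts with its own class of letters, and different classes are disjoint.
From number 4 on a nonterminal is allowed every first letter, so the inclusion in `head` is
automatic. -/
theorem Template.Good.inst {τ : Template} (h : τ.Good) {c s : ℕ} (hc : 4 ≤ c) (hs : s ≤ c) :
    (τ.inst c s).Good c where
  head α hα := by
    obtain ⟨β, hβ, rfl⟩ := List.mem_map.1 hα
    obtain ⟨i, hi⟩ := h.head β hβ
    obtain ⟨γ, rfl⟩ := List.head?_eq_some_iff.1 hi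
    refine ⟨_, _, List.map_cons, ?_⟩
    have : ¬ c < 4 := by omega
    simp [firstLetters, this]
  pairwise := by
    rw [Template.inst, List.pairwise_map]
    refine h.pairwise.imp_of_mem fun {α β} hα hβ hne => ?_
    obtain ⟨i, hi⟩ := h.head α hα
    obtain ⟨j, hj⟩ := h.head β hβ
    simp only [List.head?_map, hi, hj, Option.map_some, Option.mem_def, Option.some.injEq,
      forall_eq']
    have hij : (i : ℕ) ≠ j := fun hij => hne (by rw [hi, hj, Fin.ext hij])
    simp only [Ref.index, firstLetters, i.2, j.2, if_true]
    exact Set.disjoint_left.2 fun a ha ha' => hij (ha.symm.trans ha')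
  index_le α hα i hi := by
    obtain ⟨β, -, rfl⟩ := List.mem_map.1 hα
    obtain ⟨ρ, -, hρ⟩ := List.mem_map.1 hi
    obtain rfl := Symbol.nonterminal.inj hρ
    cases ρ with
    | cls i => exact (Nat.lt_of_lt_of_le i.2 hc).le
    | self => exact le_rfl
    | prev => exact Nat.sub_le c 1
    | mark => exact hs

/-- Halve the value and add a quarter if `e`. -/
def bitTemplate (e : Bool) : Template :=
  (if e then [[.cls 1]] else []) ++ [[.cls 0, .prev]]

/-- Combine the value with that of the distinguished nonterminal. -/
def wrapTemplate : Template := [[.cls 1, .prev], [.cls 0, .mark]]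

/-- A quadratic equation, whose coefficients depend on the parity of the number of bits and on the
second highest bit of a radicand. -/
def rootTemplate (par u : Bool) : Template :=
  [.cls 0, .self, .self] ::
    if par then [.cls 1] :: ((if u then [] else [[.cls 3]]) ++ [[.cls 2, .prev]])
    else (if u then [] else [[.cls 2]]) ++ [[.cls 1, .prev]]

theorem good_bitTemplate (e : Bool) : (bitTemplate e).Good := by
  cases e <;> constructor <;> simp [bitTemplate]

theorem good_wrapTemplate : wrapTemplate.Good := by
  constructor <;> simp [wrapTemplate]

theorem good_rootTemplate (par u : Bool) : (rootTemplate par u).Good := by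
  cases par <;> cases u <;> constructor <;> simp [rootTemplate]

/-- The value of the most recent definition. -/
def lastValue (val : ℕ → ℝ) (B : List Body) : ℝ := val (B.length - 1)

/-- The values of the classes of letters, and the bound from prefix-freeness. -/
structure Normalized (val : ℕ → ℝ) : Prop where
  zero : val 0 = 1 / 2
  one : val 1 = 1 / 4
  two : val 2 = 1 / 8
  three : val 3 = 1 / 16
  le_one : ∀ i, val i ≤ 1

section Values

variable {val : ℕ → ℝ} {B : List Body} {s : ℕ}

theorem lastValue_extend (τ : Template) : lastValue val (extend τ s B) = val B.length := by
  simp [lastValue, extend]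

theorem Solves.of_extend {τ : Template} (h : Solves val (extend τ s B)) : Solves val B := h.2

theorem lastValue_bitTemplate (hv : Normalized val) {e : Bool}
    (h : Solves val (extend (bitTemplate e) s B)) :
    lastValue val (extend (bitTemplate e) s B) =
      (if e then 1 / 4 else 0) + lastValue val B / 2 := by
  rw [lastValue_extend, h.1]
  cases e <;> simp [bitTemplate, Template.inst, Body.value, Ref.index, symbolValue, hv.zero,
    hv.one, lastValue] <;> ring

theorem lastValue_wrapTemplate (hv : Normalized val)
    (h : Solves val (extend wrapTemplate s B)) :
    lastValue val (extend wrapTemplate s B) = lastValue val B / 4 + val s / 2 := by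
  rw [lastValue_extend, h.1]
  simp [wrapTemplate, Template.inst, Body.value, Ref.index, symbolValue, hv.zero, hv.one,
    lastValue]
  ring

/-- The equation has the form f = f²/2 + c, that is (1 - f)² = 1 - 2c, and f ≤ 1 excludes the larger
solution. The coefficient of f² uses up the class of weight 1/2, so c has to be assembled from the
other classes, each used at most once. -/
theorem lastValue_rootTemplate (hv : Normalized val) {par u : Bool}
    (h : Solves val (extend (rootTemplate par u) s B)) :
    lastValue val (extend (rootTemplate par u) s B) =
      1 - √(1 - 2 * (if par then 1 / 4 + (if u then 0 else 1 / 16) + lastValue val B / 8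
        else (if u then 0 else 1 / 8) + lastValue val B / 4)) := by
  have h1 := h.1
  have hle := hv.le_one B.length
  rw [lastValue_extend]
  set f := val B.length with hf
  have hsq : (1 - f) ^ 2 =
      1 - 2 * (if par then 1 / 4 + (if u then 0 else 1 / 16) + lastValue val B / 8
        else (if u then 0 else 1 / 8) + lastValue val B / 4) := by
    cases par <;> cases u <;>
      simp [rootTemplate, Template.inst, Body.value, Ref.index, symbolValue, hv.zero, hv.one,
        hv.two, hv.three, ← hf] at h1 <;>
      simp only [lastValue, Bool.false_eq_true, if_false, if_true] <;> linarith
  rw [← hsq, Real.sqrt_sq (by linarith)]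
  ring

end Values

/-! ### The reduction -/

/-- Add `n` definitions that halve the value. -/
def pads (e : Bool) (s n : ℕ) (B : List Body) : List Body :=
  (extend (bitTemplate e) s)^[n] B

/-- The definitions of the classes of letters, and two initial values. -/
def initialBodies : List Body :=
  [[], [[.nonterminal 0]], classBody 3, classBody 2, classBody 1, classBody 0]

/-- The state of the construction: the definitions, the distinguished nonterminal, and an exponent
for scaling. -/
structure Build where
  bodies : List Body
  s : ℕ
  m : ℕ

/-- Definitions for a natural number, given by its bits. -/
def buildConst (m : ℕ) (bits : List Bool) : Build :=
  let B := pads false 4 (m - bits.length)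
    (bits.foldl (fun B b => extend (bitTemplate b) 4 B) initialBodies)
  ⟨extend wrapTemplate 4 B, B.length, m⟩

/-- The state of the construction while it reads the bits of a radicand. The two bits read last
are kept back. -/
structure Chain where
  bodies : List Body
  u : Bool
  v : Bool
  par : Bool

/-- Read one bit of a radicand. -/
def Chain.step (s : ℕ) (Z : Chain) (b : Bool) : Chain :=
  ⟨extend (bitTemplate !Z.u) s Z.bodies, Z.v, b, !Z.par⟩

/-- The state before the first bit of a radicand. -/
def Chain.start (s : ℕ) (B : List Body) : Chain :=
  ⟨extend [[.cls 0]] s B, false, false, false⟩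

/-- The definition of the root, unless the radicand vanishes. -/
def Chain.root (s : ℕ) (Z : Chain) : List Body :=
  if Z.v then extend (bitTemplate false) s (extend (rootTemplate Z.par Z.u) s Z.bodies)
  else Z.bodies

/-- Definitions for a square root, given by the bits of the radicand. -/
def buildRoot (st : Build) (bits : List Bool) : Build :=
  let B := pads true st.s (st.m + 1 - (bits.length + 1) / 2)
    (Chain.root st.s (bits.foldl (Chain.step st.s) (Chain.start st.s st.bodies)))
  ⟨extend wrapTemplate st.s B, B.length, st.m + 1⟩


/-! ### Bits -/

/-- The number with given binary digits, least significant digit first. -/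
def bitsValue (l : List Bool) : ℕ := l.foldr (fun b n => b.toNat + 2 * n) 0

theorem bitsValue_bits (d : ℕ) : bitsValue d.bits = d := by
  induction d using Nat.binaryRec' with
  | zero => simp [bitsValue]
  | bit b n h ih =>
    rw [Nat.bits_append_bit n b h]
    simp only [bitsValue, List.foldr_cons] at ih ⊢
    rw [ih, Nat.bit_val]
    ring

/-- Hence the bit `v` kept back after a whole radicand tells whether the radicand is nonzero. -/
theorem getLast?_bits {d : ℕ} (hd : d ≠ 0) : d.bits.getLast? = some true := by
  induction d using Nat.binaryRec' with
  | zero => simp at hd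
  | bit b n h ih =>
    rw [Nat.bits_append_bit n b h]
    by_cases hn : n = 0
    · simp [hn, h hn]
    · simp [List.getLast?_cons, ih hn]

/-- The least significant digit comes first, so every halving shifts the earlier digits down by one
place of a binary fraction. -/
theorem foldl_half (l : List Bool) (t : ℝ) :
    l.foldl (fun t b => ((if b then 1 else 0) + t) / 2) t =
      (t + bitsValue l) / 2 ^ l.length := by
  induction l generalizing t with
  | nil => simp [bitsValue]
  | cons b l ih =>
    rw [List.foldl_cons, ih, List.length_cons]
    have : (bitsValue (b :: l) : ℝ) = (if b then 1 else 0) + 2 * bitsValue l := by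
      cases b <;> simp [bitsValue]
    rw [this, pow_succ]
    field_simp
    ring

/-! ### The values of the definitions of the reduction -/

section Values

variable {val : ℕ → ℝ} {B : List Body} {s : ℕ}

theorem Solves.of_pads {e : Bool} {n : ℕ} (h : Solves val (pads e s n B)) : Solves val B := by
  induction n generalizing B with
  | zero => exact h
  | succ n ih => exact (ih (B := extend (bitTemplate e) s B) h).of_extend

/-- One padding is y ↦ y/2 or y ↦ 1/4 + y/2: a contraction by 1/2 with fixed point 0 or 1/2
respectively. -/
theorem lastValue_pads (hv : Normalized val) {e : Bool} {n : ℕ}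
    (h : Solves val (pads e s n B)) :
    lastValue val (pads e s n B) =
      (if e then 1 / 2 else 0) + (lastValue val B - if e then 1 / 2 else 0) / 2 ^ n := by
  induction n generalizing B with
  | zero => simp [pads]
  | succ n ih =>
    have h' : Solves val (extend (bitTemplate e) s B) := Solves.of_pads (n := n) h
    rw [pads, Function.iterate_succ_apply, ← pads, ih h, lastValue_bitTemplate hv h', pow_succ]
    cases e <;> simp only [Bool.false_eq_true, if_false, if_true] <;> field_simp <;> ring

/-- The class of weight 1/2 serves for the halving, so a digit 1 can only add 1/4; the nonterminals
therefore carry half of the binary fraction. -/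
theorem lastValue_foldl_bitTemplate (hv : Normalized val) {l : List Bool}
    (h : Solves val (l.foldl (fun B b => extend (bitTemplate b) s B) B)) :
    Solves val B ∧ lastValue val (l.foldl (fun B b => extend (bitTemplate b) s B) B) =
      l.foldl (fun t b => ((if b then 1 else 0) + t) / 2) (2 * lastValue val B) / 2 := by
  induction l generalizing B with
  | nil => exact ⟨h, by simp⟩
  | cons b l ih =>
    obtain ⟨h1, h2⟩ := ih h
    refine ⟨h1.of_extend, ?_⟩
    rw [List.foldl_cons, List.foldl_cons, h2, lastValue_bitTemplate hv h1]
    congr 2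
    cases b <;> simp <;> ring

/-- Nonterminal 5 has no productions and supplies the value 0 from which the bits of d₀ are read;
nonterminal 4 copies the largest class and supplies the 1/2 for the first mixing. -/
theorem lastValue_initialBodies (h : Solves val initialBodies) :
    lastValue val initialBodies = 0 ∧ val 4 = 1 / 2 ∧ val 0 = 1 / 2 ∧ val 1 = 1 / 4 ∧
      val 2 = 1 / 8 ∧ val 3 = 1 / 16 := by
  have hc : ∀ i, (classBody i).value val =
      (((List.finRange 31).filter fun a => letterClass a = i).length : ℝ) / 32 := by
    intro i
    simp only [classBody, Body.value, List.map_map, Function.comp_def, List.map_cons,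
      List.map_nil, List.prod_singleton, symbolValue, List.map_const', List.sum_replicate,
      nsmul_eq_mul]
    ring
  have n0 : ((List.finRange 31).filter fun a => letterClass a = 0).length = 16 := by decide
  have n1 : ((List.finRange 31).filter fun a => letterClass a = 1).length = 8 := by decide
  have n2 : ((List.finRange 31).filter fun a => letterClass a = 2).length = 4 := by decide
  have n3 : ((List.finRange 31).filter fun a => letterClass a = 3).length = 2 := by decide
  simp only [initialBodies, Solves, hc, n0, n1, n2, n3, List.length_cons, List.length_nil] at h
  obtain ⟨h5, h4, h3, h2, h1, h0, -⟩ := h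
  norm_num at h0 h1 h2 h3 h4 h5
  simp only [Body.value, symbolValue, List.map_cons, List.map_nil, List.prod_singleton,
    List.sum_singleton, List.sum_nil] at h4 h5
  refine ⟨h5, ?_, ?_, ?_, ?_, ?_⟩ <;> linarith

/-- The bits give d/2^(ℓ+1) for ℓ bits, the padding d/2^(m+1), and the mixing with 1/2 gives 1/4 +
d/2^(m+3). This is the invariant with δ = -d: the integer has the sign opposite to that of the
roots. -/
theorem value_buildConst (hv : Normalized val) (h4 : val 4 = 1 / 2)
    (h0 : lastValue val initialBodies = 0) {m d : ℕ} (hm : d.bits.length ≤ m)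
    (h : Solves val (buildConst m d.bits).bodies) :
    val (buildConst m d.bits).s = 1 / 4 - (-d) / 2 ^ (m + 3) := by
  have h1 := h.of_extend
  have h2 := Solves.of_pads h1
  refine (lastValue_extend (s := 4) wrapTemplate).symm.trans
    ((lastValue_wrapTemplate hv h).trans ?_)
  rw [lastValue_pads hv h1, (lastValue_foldl_bitTemplate hv h2).2, foldl_half, bitsValue_bits, h0,
    h4]
  obtain ⟨k, rfl⟩ := Nat.exists_eq_add_of_le hm
  simp only [Bool.false_eq_true, if_false, Nat.add_sub_cancel_left, pow_add]
  field_simp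
  ring

/-- What is known while the bits of a radicand are read: the number `t` given by the bits read so
far, as a binary fraction, is determined by the two bits kept back and by the value of the last
definition. -/
def Chain.Represents (val : ℕ → ℝ) (Z : Chain) (t : ℝ) : Prop :=
  t = (if Z.v then 1 / 2 else 0) + (if Z.u then 1 / 4 else 0) +
    (1 - 2 * lastValue val Z.bodies) / 4

/-- If r is the binary fraction of the bits not kept back, the last definition has the value (1 -
r)/2. The complement is stored because c = (1 - t)/2 in the quadratic equation decreases with t;
appending the digit `u` to r amounts to adding the template for `!u`. -/
theorem Chain.represents_foldl (hv : Normalized val) {l : List Bool} {Z : Chain}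
    (h : Solves val (l.foldl (Chain.step s) Z).bodies) :
    Solves val Z.bodies ∧ ∀ t, Z.Represents val t → (l.foldl (Chain.step s) Z).Represents val
      (l.foldl (fun t b => ((if b then 1 else 0) + t) / 2) t) := by
  induction l generalizing Z with
  | nil => exact ⟨h, fun t ht => ht⟩
  | cons b l ih =>
    obtain ⟨h1, h2⟩ := ih h
    refine ⟨h1.of_extend, fun t ht => ?_⟩
    refine h2 _ ?_
    unfold Chain.Represents at ht ⊢
    have := lastValue_bitTemplate hv h1
    simp only [Chain.step] at this ⊢
    rw [this, ht]
    rcases Z with ⟨B, u, v, p⟩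
    cases b <;> cases u <;> cases v <;> simp <;> ring

theorem Chain.par_foldl (l : List Bool) (Z : Chain) :
    (l.foldl (Chain.step s) Z).par = (Z.par ^^ decide (l.length % 2 = 1)) := by
  induction l generalizing Z with
  | nil => simp
  | cons b l ih =>
    rw [List.foldl_cons, ih, List.length_cons]
    rcases Nat.mod_two_eq_zero_or_one l.length with h | h <;>
      cases hp : Z.par <;> simp [Chain.step, hp, h, Nat.add_mod]

theorem Chain.v_foldl (l : List Bool) (Z : Chain) :
    (l.foldl (Chain.step s) Z).v = l.getLast?.getD Z.v := by
  induction l generalizing Z with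
  | nil => simp
  | cons b l ih =>
    rw [List.foldl_cons, ih, List.getLast?_cons]
    simp [Chain.step]

theorem Solves.of_root {Z : Chain} (h : Solves val (Z.root s)) : Solves val Z.bodies := by
  unfold Chain.root at h
  split_ifs at h
  · exact h.of_extend.of_extend
  · exact h

/-- With leading digit 1 and last value y, t = 1/2 + u/4 + (1 - 2y)/4. The constants in
`rootTemplate` are the solutions of 1 - 2c = t, or of 1 - 2c = t/2 if `par` holds. Fixing the
leading digit makes c small enough for the classes left over by the quadratic term. The final
`bitTemplate false` halves the result. -/
theorem lastValue_root (hv : Normalized val) {Z : Chain} (h : Solves val (Z.root s))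
    (hZ : Z.v = true) {t : ℝ} (ht : Z.Represents val t) :
    lastValue val (Z.root s) = 1 / 2 - √(if Z.par then t / 2 else t) / 2 := by
  unfold Chain.root at h ⊢
  rw [if_pos hZ] at h ⊢
  rw [lastValue_bitTemplate hv h, lastValue_rootTemplate hv h.of_extend]
  unfold Chain.Represents at ht
  rw [hZ] at ht
  have : (1 - 2 * (if Z.par then 1 / 4 + (if Z.u then 0 else 1 / 16) +
      lastValue val Z.bodies / 8 else (if Z.u then 0 else 1 / 8) +
      lastValue val Z.bodies / 4) : ℝ) = if Z.par then t / 2 else t := by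
    rw [ht]
    cases Z.par <;> cases Z.u <;> simp <;> ring
  rw [this]
  simp only [Bool.false_eq_true, if_false]
  ring

theorem sqrt_div_four_pow (d : ℝ) (n : ℕ) : √(d / 4 ^ n) = √d / 2 ^ n := by
  rw [Real.sqrt_div' d (by positivity), show (4 : ℝ) ^ n = (2 ^ n) ^ 2 by
    rw [← pow_mul, mul_comm, pow_mul]; norm_num, Real.sqrt_sq (by positivity)]

/-- For an odd number of bits the additional factor 1/2 makes the exponent even, so the radicand is
d/4^h, with h half the length rounded up, and its root is √d/2^h. If d = 0 no equation is added, and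
the starting value 1/2 is already the required one. -/
theorem lastValue_root_foldl (hv : Normalized val) {d : ℕ}
    (h : Solves val ((d.bits.foldl (Chain.step s) (Chain.start s B)).root s)) :
    Solves val B ∧ lastValue val ((d.bits.foldl (Chain.step s) (Chain.start s B)).root s) =
      1 / 2 - √d / 2 ^ ((d.bits.length + 1) / 2 + 1) := by
  obtain ⟨h1, h2⟩ := Chain.represents_foldl hv h.of_root
  refine ⟨h1.of_extend, ?_⟩
  have hstart : lastValue val (Chain.start s B).bodies = 1 / 2 := by
    have := h1.1
    simp only [Chain.start] at this ⊢
    rw [lastValue_extend]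
    rw [this]
    simp [Template.inst, Body.value, Ref.index, symbolValue, hv.zero]
  have ht := h2 0 (by unfold Chain.Represents; rw [hstart]; simp [Chain.start])
  by_cases hd : d = 0
  · subst hd
    simp only [Nat.zero_bits, List.foldl_nil, Chain.root] at *
    simp [Chain.start] at hstart ⊢
    exact hstart
  · rw [lastValue_root hv h (by simp [Chain.v_foldl, getLast?_bits hd]) ht, foldl_half,
      bitsValue_bits, Chain.par_foldl]
    have : (if (Chain.start s B).par ^^ decide (d.bits.length % 2 = 1) then
        (0 + (d : ℝ)) / 2 ^ d.bits.length / 2 else (0 + (d : ℝ)) / 2 ^ d.bits.length) =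
        d / 4 ^ ((d.bits.length + 1) / 2) := by
      have h4 : ∀ n : ℕ, (4 : ℝ) ^ n = 2 ^ (2 * n) := fun n => by rw [pow_mul]; norm_num
      rw [h4]
      rcases Nat.mod_two_eq_zero_or_one d.bits.length with hl | hl
      · have : 2 * ((d.bits.length + 1) / 2) = d.bits.length := by omega
        rw [this]
        simp [Chain.start, hl]
      · have : 2 * ((d.bits.length + 1) / 2) = d.bits.length + 1 := by omega
        rw [this, pow_succ]
        simp [Chain.start, hl, div_div]
    rw [this, sqrt_div_four_pow, pow_succ, div_div]

/-- Padding towards 1/2 yields 1/2 - √d/2^(m+2). A quarter of this plus half of 1/4 - δ/2^(m+3) has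
constant term 1/4, and both deviations get the denominator 2^(m+4). -/
theorem value_buildRoot (hv : Normalized val) {st : Build} {d : ℕ} (hm : d.bits.length ≤ st.m)
    (h : Solves val (buildRoot st d.bits).bodies) :
    Solves val st.bodies ∧ ∀ δ : ℝ, val st.s = 1 / 4 - δ / 2 ^ (st.m + 3) →
      val (buildRoot st d.bits).s = 1 / 4 - (δ + √d) / 2 ^ ((buildRoot st d.bits).m + 3) := by
  have h1 := h.of_extend
  have h2 := Solves.of_pads h1
  obtain ⟨h3, h4⟩ := lastValue_root_foldl hv h2
  refine ⟨h3, fun δ hδ => ?_⟩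
  refine (lastValue_extend (s := st.s) wrapTemplate).symm.trans
    ((lastValue_wrapTemplate hv h).trans ?_)
  rw [lastValue_pads hv h1, h4, hδ, show (buildRoot st d.bits).m = st.m + 1 from rfl]
  obtain ⟨k, hk⟩ := Nat.exists_eq_add_of_le
    (show (d.bits.length + 1) / 2 ≤ st.m + 1 by omega)
  have hm4 : (2 : ℝ) ^ (st.m + 3) = 2 ^ ((d.bits.length + 1) / 2 + k + 3) / 2 := by
    rw [show (d.bits.length + 1) / 2 + k + 3 = st.m + 3 + 1 by omega, pow_succ]; ring
  simp only [if_true, hm4, hk, Nat.add_sub_cancel_left, pow_add]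
  field_simp
  ring

end Values


/-! ### Polynomial size, and correctness of the reduction. -/

/-! ### The size of the constructed grammar -/

/-- The encoding of a symbol whose nonterminals are numbered. -/
def encodeRawSymbol : Symbol (Fin 31) ℕ → List Token
  | .terminal a => .term :: encodeUnary a
  | .nonterminal i => .nonterm :: encodeUnary i

/-- The encoding of a production for the nonterminal with number `c`. -/
def encodeRawRule (c : ℕ) (α : List (Symbol (Fin 31) ℕ)) : List Token :=
  .rule :: (encodeUnary c ++ (α.flatMap encodeRawSymbol ++ [.fin]))

/-- The encoding of a list of definitions. -/
def encodeBodies : List Body → List Token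
  | [] => []
  | b :: B => b.flatMap (encodeRawRule B.length) ++ encodeBodies B

theorem length_encodeUnary (n : ℕ) : (encodeUnary n).length = n + 1 := by
  simp [encodeUnary]

/-- The size of a list of definitions. -/
def size (B : List Body) : ℕ := (encodeBodies B).length + B.length

theorem List.length_flatMap_le {α β : Type*} {f : α → List β} {l : List α} {n : ℕ}
    (h : ∀ a ∈ l, (f a).length ≤ n) : (l.flatMap f).length ≤ l.length * n := by
  rw [List.length_flatMap]
  refine (List.sum_le_card_nsmul _ n ?_).trans (by simp)
  simpa using h

/-- At most four productions with at most three symbols on the right are added; every index is at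
most `B.length` and is written in unary. -/
theorem size_extend_le {τ : Template} (hτ : τ.Good) {s : ℕ} {B : List Body} (hB : 4 ≤ B.length)
    (hs : s ≤ B.length) : size (extend τ s B) ≤ size B + (16 * B.length + 37) := by
  have h : ∀ α ∈ τ.inst B.length s, (encodeRawRule B.length α).length ≤ 4 * B.length + 9 := by
    intro α hα
    obtain ⟨β, hβ, rfl⟩ := List.mem_map.1 hα
    have h₁ : ∀ σ ∈ β.map fun ρ => (.nonterminal (ρ.index B.length s) : Symbol (Fin 31) ℕ),
        (encodeRawSymbol σ).length ≤ B.length + 2 := by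
      intro σ hσ
      obtain ⟨ρ, -, rfl⟩ := List.mem_map.1 hσ
      have : ρ.index B.length s ≤ B.length := by
        cases ρ with
        | cls i => exact (Nat.lt_of_lt_of_le i.2 hB).le
        | self => exact le_rfl
        | prev => exact Nat.sub_le _ 1
        | mark => exact hs
      simpa [encodeRawSymbol, length_encodeUnary] using this
    have h₂ := List.length_flatMap_le h₁
    have h₃ := Nat.mul_le_mul_right (B.length + 2) (hτ.length_le_of_mem β hβ)
    rw [List.length_map] at h₂
    simp only [encodeRawRule, List.length_cons, List.length_append, length_encodeUnary,
      List.length_nil]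
    omega
  have h₁ := List.length_flatMap_le h
  have h₂ := Nat.mul_le_mul_right (4 * B.length + 9) hτ.length_le
  rw [show (τ.inst B.length s).length = τ.length from List.length_map _] at h₁
  simp only [size, extend, encodeBodies, List.length_append, List.length_cons]
  omega

/-! ### The constructed definitions are good -/

/-- The conditions that are maintained by the construction. -/
structure GoodState (s : ℕ) (B : List Body) : Prop where
  good : GoodBodies B
  length : 6 ≤ B.length
  lt : s < B.length
  size_le : size B ≤ B.length * (16 * B.length + 200)

section Good

variable {s : ℕ} {B : List Body}

theorem GoodState.extend (h : GoodState s B) {τ : Template} (hτ : τ.Good) :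
    GoodState s (extend τ s B) where
  good := ⟨hτ.inst (by have := h.length; omega) h.lt.le, h.good⟩
  length := by simpa [_root_.extend] using h.length.trans (Nat.le_succ _)
  lt := by simpa [_root_.extend] using h.lt.trans (Nat.lt_succ_self _)
  size_le := by
    have h₁ := size_extend_le hτ (by have := h.length; omega) h.lt.le
    have h₂ := h.size_le
    rw [show (_root_.extend τ s B).length = B.length + 1 from rfl]
    linarith

theorem GoodState.pads (h : GoodState s B) (e : Bool) (n : ℕ) : GoodState s (pads e s n B) := by
  induction n generalizing B with
  | zero => exact h
  | succ n ih => exact ih (h.extend (good_bitTemplate e))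

/-- The mixed value becomes the distinguished one; its number is the number of definitions before
it. -/
theorem GoodState.wrap (h : GoodState s B) :
    GoodState B.length (_root_.extend wrapTemplate s B) where
  good := (h.extend good_wrapTemplate).good
  length := (h.extend good_wrapTemplate).length
  lt := by simp [_root_.extend]
  size_le := (h.extend good_wrapTemplate).size_le

theorem GoodState.foldl_bitTemplate (h : GoodState s B) (l : List Bool) :
    GoodState s (l.foldl (fun B b => _root_.extend (bitTemplate b) s B) B) := by
  induction l generalizing B with
  | nil => exact h
  | cons b l ih => exact ih (h.extend (good_bitTemplate b))

theorem good_classBody {i : ℕ} (hi : i < 4) : (classBody i).Good i where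
  head α hα := by
    simp only [classBody, List.mem_map, List.mem_filter, decide_eq_true_eq] at hα
    obtain ⟨a, ⟨-, ha⟩, rfl⟩ := hα
    refine ⟨_, _, rfl, ?_⟩
    simpa [firstLetters, hi] using ha
  pairwise := by
    rw [classBody, List.pairwise_map]
    refine ((List.nodup_finRange 31).filter _).imp fun {a b} hab => ?_
    simpa [firstLetters] using hab.symm
  index_le α hα j hj := by
    simp only [classBody, List.mem_map] at hα
    obtain ⟨a, -, rfl⟩ := hα
    simp at hj

theorem goodState_initialBodies : GoodState 4 initialBodies where
  good := by
    refine ⟨⟨by simp, by simp, by simp⟩, ⟨?_, by simp, by simp⟩, good_classBody (by norm_num),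
      good_classBody (by norm_num), good_classBody (by norm_num), good_classBody (by norm_num),
      trivial⟩
    simp [firstLetters, classBody]
  length := by simp [initialBodies]
  lt := by simp [initialBodies]
  size_le := by decide +kernel

theorem GoodState.foldl_step {l : List Bool} {Z : Chain} (h : GoodState s Z.bodies) :
    GoodState s (l.foldl (Chain.step s) Z).bodies := by
  induction l generalizing Z with
  | nil => exact h
  | cons b l ih => exact ih (Z := Z.step s b) (h.extend (good_bitTemplate _))

theorem GoodState.root {Z : Chain} (h : GoodState s Z.bodies) : GoodState s (Z.root s) := by
  unfold Chain.root
  split_ifs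
  · exact (h.extend (good_rootTemplate _ _)).extend (good_bitTemplate _)
  · exact h

theorem goodState_buildConst (m : ℕ) (bits : List Bool) :
    GoodState (buildConst m bits).s (buildConst m bits).bodies :=
  ((goodState_initialBodies.foldl_bitTemplate bits).pads _ _).wrap

theorem goodState_buildRoot {st : Build} (h : GoodState st.s st.bodies) (bits : List Bool) :
    GoodState (buildRoot st bits).s (buildRoot st bits).bodies :=
  (GoodState.pads (GoodState.root (GoodState.foldl_step (Z := Chain.start st.s st.bodies)
    (h.extend (τ := [[.cls 0]]) (by constructor <;> simp)))) _ _).wrap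

end Good

/-! ### The reduction -/

/-- The construction for a list of radicands. -/
def buildRoots (st : Build) (ds : List ℕ) : Build :=
  ds.foldl (fun st d => buildRoot st d.bits) st

theorem goodState_buildRoots {st : Build} (h : GoodState st.s st.bodies) (ds : List ℕ) :
    GoodState (buildRoots st ds).s (buildRoots st ds).bodies := by
  induction ds generalizing st with
  | nil => exact h
  | cons d ds ih => exact ih (goodState_buildRoot h d.bits)

/-- Every root raises `m` by one, so a bound on the bit lengths by the initial `m` stays valid while
δ accumulates the roots. -/
theorem value_buildRoots {val : ℕ → ℝ} (hv : Normalized val) {st : Build} {ds : List ℕ}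
    (hm : ∀ d ∈ ds, d.bits.length ≤ st.m) (h : Solves val (buildRoots st ds).bodies) :
    Solves val st.bodies ∧ ∀ δ : ℝ, val st.s = 1 / 4 - δ / 2 ^ (st.m + 3) →
      val (buildRoots st ds).s =
        1 / 4 - (δ + (ds.map fun d : ℕ => √(d : ℝ)).sum) / 2 ^ ((buildRoots st ds).m + 3) := by
  induction ds generalizing st with
  | nil => exact ⟨h, fun δ hδ => by simpa [buildRoots] using hδ⟩
  | cons d ds ih =>
    obtain ⟨h1, h2⟩ := ih (st := buildRoot st d.bits)
      (fun e he => (hm e (by simp [he])).trans (Nat.le_succ _)) h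
    obtain ⟨h3, h4⟩ := value_buildRoot hv (hm d (by simp)) h1
    refine ⟨h3, fun δ hδ => ?_⟩
    rw [List.map_cons, List.sum_cons, ← add_assoc]
    exact h2 _ (h4 δ hδ)

/-- The encoding of an instance without the comparison operator. -/
def SqrtSumInstance.numbers (x : SqrtSumInstance) : List Token :=
  encodeBinary x.d₀ ++ (x.ds.flatMap encodeBinary ++ [.fin])

/-- The construction for an instance. -/
def SqrtSumInstance.build (x : SqrtSumInstance) : Build :=
  buildRoots (buildConst x.numbers.length x.d₀.bits) x.ds

theorem SqrtSumInstance.goodState_build (x : SqrtSumInstance) :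
    GoodState x.build.s x.build.bodies :=
  goodState_buildRoots (goodState_buildConst _ _) _

theorem Solves.of_foldl_bitTemplate {val : ℕ → ℝ} {B : List Body} {s : ℕ} {l : List Bool}
    (h : Solves val (l.foldl (fun B b => extend (bitTemplate b) s B) B)) : Solves val B := by
  induction l generalizing B with
  | nil => exact h
  | cons b l ih => exact (ih h).of_extend

theorem Solves.of_foldl_step {val : ℕ → ℝ} {s : ℕ} {l : List Bool} {Z : Chain}
    (h : Solves val (l.foldl (Chain.step s) Z).bodies) : Solves val Z.bodies := by
  induction l generalizing Z with
  | nil => exact h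
  | cons b l ih => exact (ih (Z := Z.step s b) h).of_extend

theorem Solves.of_buildRoots {val : ℕ → ℝ} {st : Build} {ds : List ℕ}
    (h : Solves val (buildRoots st ds).bodies) : Solves val st.bodies := by
  induction ds generalizing st with
  | nil => exact h
  | cons d ds ih =>
    exact (ih h).of_extend.of_pads.of_root.of_foldl_step.of_extend

theorem SqrtSumInstance.length_bits_le (x : SqrtSumInstance) :
    x.d₀.bits.length ≤ x.numbers.length := by
  simp [SqrtSumInstance.numbers, encodeBinary]

theorem SqrtSumInstance.length_bits_le_of_mem (x : SqrtSumInstance) :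
    ∀ d ∈ x.ds, d.bits.length ≤ x.numbers.length := by
  intro d hd
  have : d.bits.length ≤ (x.ds.flatMap encodeBinary).length := by
    rw [List.length_flatMap]
    refine le_trans ?_ (List.le_sum_of_mem (List.mem_map_of_mem hd))
    simp [encodeBinary]
  simp only [SqrtSumInstance.numbers, List.length_append]
  omega

theorem SqrtSumInstance.value_build (x : SqrtSumInstance) {val : ℕ → ℝ}
    (h : Solves val x.build.bodies) (hle : ∀ i, val i ≤ 1) :
    val x.build.s =
      1 / 4 - ((x.ds.map fun d : ℕ => √(d : ℝ)).sum - x.d₀) / 2 ^ (x.build.m + 3) := by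
  have hb : Solves val (buildConst x.numbers.length x.d₀.bits).bodies := h.of_buildRoots
  obtain ⟨i5, i4, i0, i1, i2, i3⟩ :=
    lastValue_initialBodies hb.of_extend.of_pads.of_foldl_bitTemplate
  have hv : Normalized val := ⟨i0, i1, i2, i3, hle⟩
  rw [sub_eq_neg_add _ (x.d₀ : ℝ)]
  exact (value_buildRoots hv x.length_bits_le_of_mem h).2 _
    (value_buildConst hv i4 i5 x.length_bits_le hb)

/-- Exchange `≤` and `≥`, and `<` and `>`. -/
def CompOp.swap : CompOp → CompOp
  | .le => .ge
  | .lt => .gt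
  | .gt => .lt
  | .ge => .le

/-- The grammar that is constructed for an instance. -/
def SqrtSumInstance.presentation (x : SqrtSumInstance) : CFGPresentation :=
  presentationOf x.build.bodies x.build.s x.goodState_build.lt

/-- The reduction. -/
def SqrtSumInstance.reduce (x : SqrtSumInstance) : CoinFlipInstance where
  op := x.op.swap
  p := 1
  q := 128
  q_pos := by norm_num
  p_le_q := by norm_num
  G := x.presentation
  unambiguous :=
    haveI : NeZero x.build.bodies.length := ⟨by have := x.goodState_build.lt; omega⟩
    (predictiveOf (start := ⟨x.build.s, x.goodState_build.lt⟩) x.goodState_build.good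
      rfl).unambiguous

/-- The measure is 1/128 minus a positive multiple of the sum of the roots minus d₀, which explains
the reversed operator. The strict comparisons are negations of the weak ones. -/
theorem SqrtSumInstance.yes_reduce (x : SqrtSumInstance) : x.reduce.Yes ↔ x.Yes := by
  have : NeZero x.build.bodies.length := ⟨by have := x.goodState_build.lt; omega⟩
  obtain ⟨val, h1, h2, h3⟩ := exists_value_grammarOf x.goodState_build.lt x.goodState_build.good rfl
  have hval := x.value_build h1 h2
  have h4 : coinFlipMeasure x.reduce.G.grammar.language = 1 / 32 * val x.build.s := h3
  have hpos : (0 : ℝ) < 2 ^ (x.build.m + 3) := by positivity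
  have hS : (x.ds.map fun d => √(d : ℝ)).sum = (x.ds.map fun d : ℕ => √(d : ℝ)).sum := by
    -- On the left the list itself is coerced entry by entry to a list of reals, and the roots are
    -- taken afterwards.
    change ((x.ds.flatMap fun d : ℕ => [(d : ℝ)]).map fun d => √d).sum = _
    rw [← List.map_eq_flatMap, List.map_map]
    rfl
  unfold CoinFlipInstance.Yes SqrtSumInstance.Yes
  rw [h4, hval, hS]
  generalize (x.ds.map fun d : ℕ => √(d : ℝ)).sum = S
  have hle : ∀ a b : ℝ, (1 / 32 * (1 / 4 - (a - b) / 2 ^ (x.build.m + 3)) ≥ 1 / 128 ↔ a ≤ b) := by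
    intro a b
    have : 0 ≤ (b - a) / 2 ^ (x.build.m + 3) ↔ a ≤ b := by
      rw [le_div_iff₀ hpos, zero_mul, sub_nonneg]
    rw [← this, ← neg_sub b a, neg_div]
    constructor <;> intro h <;> linarith
  have hge : ∀ a b : ℝ, (1 / 32 * (1 / 4 - (a - b) / 2 ^ (x.build.m + 3)) ≤ 1 / 128 ↔ b ≤ a) := by
    intro a b
    have : 0 ≤ (a - b) / 2 ^ (x.build.m + 3) ↔ b ≤ a := by
      rw [le_div_iff₀ hpos, zero_mul, sub_nonneg]
    rw [← this]
    constructor <;> intro h <;> linarith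
  have hq : ((x.reduce.p : ℕ) : ℝ) / ((x.reduce.q : ℕ) : ℝ) = 1 / 128 := by
    simp [SqrtSumInstance.reduce]
  rw [hq]
  change x.op.swap.Rel _ _ ↔ _
  cases x.op
  · exact hle S x.d₀
  · exact not_le.symm.trans ((not_congr (hge S x.d₀)).trans not_le)
  · exact not_le.symm.trans ((not_congr (hle S x.d₀)).trans not_le)
  · exact hge S x.d₀


/-! ### Writing the grammar with a stack program, and the running time. -/

/-! ### The encoding of the constructed grammar -/

/-- By `index_le` all numbers are below `k`, so reduction modulo `k` is harmless and the grammar can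
be written directly from the numbered definitions. -/
theorem flatMap_encodeRule_productions {k : ℕ} [NeZero k] {B : List Body} (hB : GoodBodies B)
    (hk : B.length ≤ k) : (productions k B).flatMap encodeRule = encodeBodies B := by
  induction B with
  | nil => rfl
  | cons b B ih =>
    simp only [List.length_cons] at hk
    have hmod : ∀ i, i ≤ B.length → i % k = i := fun i hi => Nat.mod_eq_of_lt (by omega)
    rw [productions, encodeBodies, List.flatMap_append, ih hB.2 (by omega), List.flatMap_map]
    congr 1
    refine List.flatMap_congr fun α hα => ?_
    have hα' : (α.map (toFinSymbol k)).flatMap encodeSymbol = α.flatMap encodeRawSymbol := by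
      rw [List.flatMap_map]
      refine List.flatMap_congr fun σ hσ => ?_
      cases σ with
      | terminal a => rfl
      | nonterminal i =>
        simp [toFinSymbol, encodeSymbol, encodeRawSymbol,
          hmod i (hB.1.index_le α hα i hσ)]
    simp only [encodeRule, encodeRawRule, hα', Fin.val_ofNat, hmod B.length le_rfl]

theorem SqrtSumInstance.encode_reduce (x : SqrtSumInstance) :
    x.reduce.encode = .op x.op.swap :: (encodeBinary 1 ++ (encodeBinary 128 ++ (encodeUnary 31 ++
      (encodeUnary x.build.bodies.length ++ (encodeUnary x.build.s ++
        (encodeBodies x.build.bodies ++ [.fin])))))) := by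
  have : NeZero x.build.bodies.length := ⟨by have := x.goodState_build.lt; omega⟩
  have h := flatMap_encodeRule_productions x.goodState_build.good le_rfl
  rw [← h]
  rfl

/-! ### Running programs within a bound -/

/-- `Runs p σ σ' a b` : from `σ` the program `p` leads to `σ'` after at most `b - a` steps. -/
def Runs (p : Prog) (σ σ' : Store) (a b : ℕ) : Prop :=
  ∃ t, Exec p σ σ' t ∧ t + a ≤ b

namespace Runs

theorem basic {is : List Instr} {σ σ' : Store} (h : is.foldl Instr.apply σ = σ') {a b : ℕ}
    (hab : a + 1 ≤ b) : Runs (.basic is) σ σ' a b :=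
  ⟨1, .basic' h, by omega⟩

/-- The last two arguments act as clock readings, so bounds telescope under composition. Later these
readings contain multiples of the grammar size, which serves as a potential. -/
theorem seq {p q : Prog} {σ₀ σ₁ σ₂ : Store} {a b c : ℕ} (hp : Runs p σ₀ σ₁ a b)
    (hq : Runs q σ₁ σ₂ b c) : Runs (.seq p q) σ₀ σ₂ a c := by
  obtain ⟨t₁, h₁, h₁'⟩ := hp
  obtain ⟨t₂, h₂, h₂'⟩ := hq
  exact ⟨t₁ + t₂, h₁.seq h₂, by omega⟩

theorem iteFalse {c : Reg → Bool} {p q : Prog} {σ₀ σ₁ : Store} {a b : ℕ}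
    (hc : c σ₀.reg = false) (hq : Runs q σ₀ σ₁ (a + 1) b) : Runs (.ite c p q) σ₀ σ₁ a b := by
  obtain ⟨t, h, h'⟩ := hq
  exact ⟨t + 1, .iteFalse hc h, by omega⟩

theorem loopFalse {c : Reg → Bool} {p : Prog} {σ : Store} {a b : ℕ} (hc : c σ.reg = false)
    (hab : a + 1 ≤ b) : Runs (.loop c p) σ σ a b :=
  ⟨1, .loopFalse hc, by omega⟩

theorem loopTrue {c : Reg → Bool} {p : Prog} {σ₀ σ₁ σ₂ : Store} {a b d : ℕ}
    (hc : c σ₀.reg = true) (hp : Runs p σ₀ σ₁ (a + 1) b) (hl : Runs (.loop c p) σ₁ σ₂ b d) :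
    Runs (.loop c p) σ₀ σ₂ a d := by
  obtain ⟨t₁, h₁, h₁'⟩ := hp
  obtain ⟨t₂, h₂, h₂'⟩ := hl
  exact ⟨t₁ + t₂ + 1, .loopTrue hc h₁ h₂, by omega⟩

theorem mono {p : Prog} {σ σ' : Store} {a b a' b' : ℕ} (h : Runs p σ σ' a b)
    (hab : b + a' ≤ b' + a) : Runs p σ σ' a' b' := by
  obtain ⟨t, h, h'⟩ := h
  exact ⟨t, h, by omega⟩

end Runs

/-! ### Elementary programs -/

/-- Push a fixed token. -/
def put (k : Stk) (t : Token) : Instr := .push k fun _ => t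

/-- Push a fixed word. -/
def puts (k : Stk) (l : List Token) : List Instr := l.reverse.map (put k)

/-- Discard the top of a stack. -/
def drop (k : Stk) : Instr := .pop k fun r _ => r

/-- Pop a stack, and remember whether it was nonempty. -/
def popMore (k : Stk) : Instr := .pop k fun r t => { r with more := t.isSome }

/-- Pop a stack, and remember the token. -/
def popTok (k : Stk) : Instr := .pop k fun r t => { r with tok := t }

/-- The number `n` in unary, without an end marker. -/
abbrev ticks (n : ℕ) : List Token := List.replicate n .tick

theorem ticks_append_cons (n : ℕ) (l : List Token) :
    ticks n ++ .tick :: l = ticks (n + 1) ++ l := by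
  rw [ticks, ticks, List.replicate_succ', List.append_assoc]
  rfl

theorem encodeUnary_append (n : ℕ) (l : List Token) :
    encodeUnary n ++ l = ticks n ++ .comma :: l := by
  simp [encodeUnary]

theorem foldl_puts_out (l : List Token) (r : Reg) (i o c s t b u : List Token) :
    (puts .out l).foldl Instr.apply ⟨r, i, o, c, s, t, b, u⟩ =
      ⟨r, i, l ++ o, c, s, t, b, u⟩ := by
  induction l with
  | nil => rfl
  | cons a l ih =>
    rw [puts, List.reverse_cons, List.map_append, List.foldl_append, ← puts, ih]
    rfl

/-- Write the number on a stack in unary. -/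
def writeUnary (k : Stk) : Prog :=
  .seq (.basic [put .out .comma, popMore k])
    (.seq (.loop Reg.more (.basic [put .tmp .tick, put .out .tick, popMore k]))
      (.seq (.basic [popMore .tmp]) (.loop Reg.more (.basic [put k .tick, popMore .tmp]))))

/-- Whether something is left when a number in unary is popped. -/
abbrev Reg.withMore (r : Reg) (n : ℕ) : Reg := { r with more := (ticks n).head?.isSome }

section Specs

variable {r : Reg} {i o c s t b u : List Token} {n : ℕ} {a : ℕ}

theorem Reg.withMore_zero (hr : r.more = false) : r.withMore 0 = r := by
  cases r
  simp_all [Reg.withMore]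

/-- The counter is poured into `tmp` while being copied to the output, and then poured back. The
loop invariants begin after a pop, hence the register `withMore n` together with the tail of the
stack. -/
theorem runs_writeUnary_cur (hr : r.more = false) :
    Runs (writeUnary .cur) ⟨r, i, o, ticks n, s, [], b, u⟩
      ⟨r, i, encodeUnary n ++ o, ticks n, s, [], b, u⟩ a (a + 4 * n + 4) := by
  have h₁ : ∀ (n a : ℕ) (o t : List Token),
      Runs (.loop Reg.more (.basic [put .tmp .tick, put .out .tick, popMore .cur]))
        ⟨r.withMore n, i, o, (ticks n).tail, s, t, b, u⟩
        ⟨r, i, ticks n ++ o, [], s, ticks n ++ t, b, u⟩ a (a + 2 * n + 1) := by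
    intro n
    induction n with
    | zero =>
      intro a o t
      rw [Reg.withMore_zero hr]
      exact .loopFalse hr le_rfl
    | succ n ih =>
      intro a o t
      have := ih (a + 2) (.tick :: o) (.tick :: t)
      rw [ticks_append_cons, ticks_append_cons] at this
      exact (Runs.loopTrue rfl (.basic rfl le_rfl) this).mono (by omega)
  have h₂ : ∀ (n a : ℕ) (c o : List Token),
      Runs (.loop Reg.more (.basic [put .cur .tick, popMore .tmp]))
        ⟨r.withMore n, i, o, c, s, (ticks n).tail, b, u⟩
        ⟨r, i, o, ticks n ++ c, s, [], b, u⟩ a (a + 2 * n + 1) := by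
    intro n
    induction n with
    | zero =>
      intro a c o
      rw [Reg.withMore_zero hr]
      exact .loopFalse hr le_rfl
    | succ n ih =>
      intro a c o
      have := ih (a + 2) (.tick :: c) o
      rw [ticks_append_cons] at this
      exact (Runs.loopTrue rfl (.basic rfl le_rfl) this).mono (by omega)
  rw [encodeUnary_append]
  have h₁ := h₁ n (a + 1) (.comma :: o) []
  have h₂ := h₂ n (a + 1 + 2 * n + 1 + 1) [] (ticks n ++ .comma :: o)
  rw [List.append_nil] at h₁ h₂
  exact ((Runs.basic rfl le_rfl).seq (h₁.seq ((Runs.basic rfl le_rfl).seq h₂))).mono (by omega)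

theorem runs_writeUnary_sidx (hr : r.more = false) :
    Runs (writeUnary .sidx) ⟨r, i, o, c, ticks n, [], b, u⟩
      ⟨r, i, encodeUnary n ++ o, c, ticks n, [], b, u⟩ a (a + 4 * n + 4) := by
  have h₁ : ∀ (n a : ℕ) (o t : List Token),
      Runs (.loop Reg.more (.basic [put .tmp .tick, put .out .tick, popMore .sidx]))
        ⟨r.withMore n, i, o, c, (ticks n).tail, t, b, u⟩
        ⟨r, i, ticks n ++ o, c, [], ticks n ++ t, b, u⟩ a (a + 2 * n + 1) := by
    intro n
    induction n with
    | zero =>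
      intro a o t
      rw [Reg.withMore_zero hr]
      exact .loopFalse hr le_rfl
    | succ n ih =>
      intro a o t
      have := ih (a + 2) (.tick :: o) (.tick :: t)
      rw [ticks_append_cons, ticks_append_cons] at this
      exact (Runs.loopTrue rfl (.basic rfl le_rfl) this).mono (by omega)
  have h₂ : ∀ (n a : ℕ) (s o : List Token),
      Runs (.loop Reg.more (.basic [put .sidx .tick, popMore .tmp]))
        ⟨r.withMore n, i, o, c, s, (ticks n).tail, b, u⟩
        ⟨r, i, o, c, ticks n ++ s, [], b, u⟩ a (a + 2 * n + 1) := by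
    intro n
    induction n with
    | zero =>
      intro a s o
      rw [Reg.withMore_zero hr]
      exact .loopFalse hr le_rfl
    | succ n ih =>
      intro a s o
      have := ih (a + 2) (.tick :: s) o
      rw [ticks_append_cons] at this
      exact (Runs.loopTrue rfl (.basic rfl le_rfl) this).mono (by omega)
  rw [encodeUnary_append]
  have h₁ := h₁ n (a + 1) (.comma :: o) []
  have h₂ := h₂ n (a + 1 + 2 * n + 1 + 1) [] (ticks n ++ .comma :: o)
  rw [List.append_nil] at h₁ h₂
  exact ((Runs.basic rfl le_rfl).seq (h₁.seq ((Runs.basic rfl le_rfl).seq h₂))).mono (by omega)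

/-- Empty a stack. -/
def clear (k : Stk) : Prog :=
  .seq (.basic [popMore k]) (.loop Reg.more (.basic [popMore k]))

theorem runs_clear_cur (hr : r.more = false) :
    Runs (clear .cur) ⟨r, i, o, ticks n, s, t, b, u⟩ ⟨r, i, o, [], s, t, b, u⟩
      a (a + 2 * n + 2) := by
  have h : ∀ n a : ℕ, Runs (.loop Reg.more (.basic [popMore .cur]))
      ⟨r.withMore n, i, o, (ticks n).tail, s, t, b, u⟩ ⟨r, i, o, [], s, t, b, u⟩
      a (a + 2 * n + 1) := by
    intro n
    induction n with
    | zero =>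
      intro a
      rw [Reg.withMore_zero hr]
      exact .loopFalse hr le_rfl
    | succ n ih =>
      intro a
      exact (Runs.loopTrue rfl (.basic rfl le_rfl) (ih (a + 2))).mono (by omega)
  exact ((Runs.basic rfl le_rfl).seq (h n (a + 1))).mono (by omega)

theorem runs_clear_sidx (hr : r.more = false) :
    Runs (clear .sidx) ⟨r, i, o, c, ticks n, t, b, u⟩ ⟨r, i, o, c, [], t, b, u⟩
      a (a + 2 * n + 2) := by
  have h : ∀ n a : ℕ, Runs (.loop Reg.more (.basic [popMore .sidx]))
      ⟨r.withMore n, i, o, c, (ticks n).tail, t, b, u⟩ ⟨r, i, o, c, [], t, b, u⟩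
      a (a + 2 * n + 1) := by
    intro n
    induction n with
    | zero =>
      intro a
      rw [Reg.withMore_zero hr]
      exact .loopFalse hr le_rfl
    | succ n ih =>
      intro a
      exact (Runs.loopTrue rfl (.basic rfl le_rfl) (ih (a + 2))).mono (by omega)
  exact ((Runs.basic rfl le_rfl).seq (h n (a + 1))).mono (by omega)

theorem runs_clear_bud (hr : r.more = false) :
    Runs (clear .bud) ⟨r, i, o, c, s, t, ticks n, u⟩ ⟨r, i, o, c, s, t, [], u⟩
      a (a + 2 * n + 2) := by
  have h : ∀ n a : ℕ, Runs (.loop Reg.more (.basic [popMore .bud]))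
      ⟨r.withMore n, i, o, c, s, t, (ticks n).tail, u⟩ ⟨r, i, o, c, s, t, [], u⟩
      a (a + 2 * n + 1) := by
    intro n
    induction n with
    | zero =>
      intro a
      rw [Reg.withMore_zero hr]
      exact .loopFalse hr le_rfl
    | succ n ih =>
      intro a
      exact (Runs.loopTrue rfl (.basic rfl le_rfl) (ih (a + 2))).mono (by omega)
  exact ((Runs.basic rfl le_rfl).seq (h n (a + 1))).mono (by omega)

end Specs

/-! ### Writing definitions -/

/-- Write a reference. -/
def writeRef : Ref → Prog
  | .cls i => .basic (puts .out (.nonterm :: encodeUnary i))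
  | .self => .seq (writeUnary .cur) (.basic [put .out .nonterm])
  | .prev => .seq (.basic [drop .cur])
      (.seq (writeUnary .cur) (.basic [put .cur .tick, put .out .nonterm]))
  | .mark => .seq (writeUnary .sidx) (.basic [put .out .nonterm])

/-- Write a list of references. -/
def writeRefs : List Ref → Prog
  | [] => .basic []
  | ρ :: α => .seq (writeRefs α) (writeRef ρ)

/-- Write a production. -/
def writeRule (α : List Ref) : Prog :=
  .seq (.basic [put .out .fin])
    (.seq (writeRefs α) (.seq (writeUnary .cur) (.basic [put .out .rule])))

/-- Write the productions given by a template. -/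
def writeRules : Template → Prog
  | [] => .basic []
  | α :: τ => .seq (writeRules τ) (writeRule α)

/-- Write the definition given by a template. -/
def define (τ : Template) : Prog :=
  .seq (writeRules τ) (.basic [put .cur .tick])

section Specs

variable {r : Reg} {i o b u : List Token} {c s : ℕ}

/-- The symbol to which a reference refers. -/
abbrev Ref.symbol (c s : ℕ) (ρ : Ref) : Symbol (Fin 31) ℕ := .nonterminal (ρ.index c s)

/-- The time is proportional to the number of tokens written, because indices are written in unary.
For `prev` one tick is removed from the counter and put back, which needs a nonzero counter. -/
theorem runs_writeRef (hr : r.more = false) (hc : c ≠ 0) (ρ : Ref) (a : ℕ) :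
    Runs (writeRef ρ) ⟨r, i, o, ticks c, ticks s, [], b, u⟩
      ⟨r, i, encodeRawSymbol (ρ.symbol c s) ++ o, ticks c, ticks s, [], b, u⟩ a
      (a + 8 * (encodeRawSymbol (ρ.symbol c s)).length) := by
  simp only [encodeRawSymbol, List.length_cons, length_encodeUnary]
  cases ρ with
  | cls j => exact .basic (foldl_puts_out _ _ _ _ _ _ _ _ _) (by omega)
  | self =>
    exact ((runs_writeUnary_cur (a := a) hr).seq (.basic rfl le_rfl)).mono
      (by simp only [Ref.index]; omega)
  | prev =>
    obtain ⟨c, rfl⟩ := Nat.exists_eq_succ_of_ne_zero hc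
    have h := runs_writeUnary_cur (n := c) (i := i) (o := o) (s := ticks s) (b := b) (u := u)
      (a := a + 1) hr
    exact ((Runs.basic rfl le_rfl).seq (h.seq (.basic rfl le_rfl))).mono
      (by simp only [Ref.index]; omega)
  | mark =>
    exact ((runs_writeUnary_sidx (a := a) hr).seq (.basic rfl le_rfl)).mono
      (by simp only [Ref.index]; omega)

/-- The list is written from its end, since the output is a stack. -/
theorem runs_writeRefs (hr : r.more = false) (hc : c ≠ 0) (α : List Ref) (a : ℕ) :
    Runs (writeRefs α) ⟨r, i, o, ticks c, ticks s, [], b, u⟩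
      ⟨r, i, (α.map (Ref.symbol c s)).flatMap encodeRawSymbol ++ o, ticks c, ticks s, [], b, u⟩ a
      (a + 8 * ((α.map (Ref.symbol c s)).flatMap encodeRawSymbol).length + 1) := by
  induction α generalizing o a with
  | nil => exact .basic rfl le_rfl
  | cons ρ α ih =>
    rw [List.map_cons, List.flatMap_cons, List.append_assoc, List.length_append]
    exact ((ih a).seq (runs_writeRef hr hc ρ _)).mono (by omega)

theorem runs_writeRule (hr : r.more = false) (hc : c ≠ 0) (α : List Ref) (a : ℕ) :
    Runs (writeRule α) ⟨r, i, o, ticks c, ticks s, [], b, u⟩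
      ⟨r, i, encodeRawRule c (α.map (Ref.symbol c s)) ++ o, ticks c, ticks s, [], b, u⟩ a
      (a + 8 * (encodeRawRule c (α.map (Ref.symbol c s))).length) := by
  simp only [encodeRawRule, List.length_cons, List.length_append, length_encodeUnary,
    List.cons_append, List.append_assoc, List.length_nil, List.nil_append]
  refine ((Runs.basic rfl le_rfl).seq ((runs_writeRefs hr hc α (a + 1)).seq
    ((runs_writeUnary_cur hr).seq (.basic rfl le_rfl)))).mono ?_
  omega

theorem runs_writeRules (hr : r.more = false) (hc : c ≠ 0) (τ : Template) (a : ℕ) :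
    Runs (writeRules τ) ⟨r, i, o, ticks c, ticks s, [], b, u⟩
      ⟨r, i, (τ.inst c s).flatMap (encodeRawRule c) ++ o, ticks c, ticks s, [], b, u⟩ a
      (a + 8 * ((τ.inst c s).flatMap (encodeRawRule c)).length + 1) := by
  induction τ generalizing o a with
  | nil => exact .basic rfl le_rfl
  | cons α τ ih =>
    rw [show Template.inst (α :: τ) c s = α.map (Ref.symbol c s) :: Template.inst τ c s from rfl,
      List.flatMap_cons, List.append_assoc, List.length_append]
    exact ((ih a).seq (runs_writeRule hr hc α _)).mono (by omega)

end Specs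

/-- The memory during the construction. -/
def mem (r : Reg) (i : List Token) (B : List Body) (s m u : ℕ) : Store :=
  ⟨r, i, encodeBodies B ++ [.fin], ticks B.length, ticks s, [], ticks m, ticks u⟩

/-- Each unit of growth of `size` pays for eight steps. The unit for the new nonterminal covers the
overhead and the tick that advances the counter. -/
theorem runs_define {r : Reg} (hr : r.more = false) {i : List Token} {B : List Body}
    (hB : B ≠ []) (s m u : ℕ) (τ : Template) (a : ℕ) :
    Runs (define τ) (mem r i B s m u) (mem r i (extend τ s B) s m u) (a + 8 * size B)
      (a + 8 * size (extend τ s B)) := by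
  have h := runs_writeRules (i := i) (o := encodeBodies B ++ [.fin]) (s := s) (b := ticks m)
    (u := ticks u) hr (List.length_pos_iff.2 hB).ne' τ a
  rw [← List.append_assoc] at h
  refine (h.seq (.basic rfl le_rfl)).mono ?_
  simp only [size, extend, encodeBodies, List.length_append, List.length_cons]
  omega


/-! ### The loops of the reduction -/

theorem ticks_tail (m : ℕ) : (ticks m).tail = ticks (m - 1) := List.tail_replicate

theorem size_extend (τ : Template) (s : ℕ) (B : List Body) : size B + 1 ≤ size (extend τ s B) := by
  simp only [size, extend, encodeBodies, List.length_append, List.length_cons]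
  omega

/-- The mixing definition contains its own number and `s` in unary; this growth pays for clearing
and recopying the index of the distinguished nonterminal. -/
theorem size_extend_wrapTemplate (s : ℕ) (B : List Body) :
    size B + B.length + s + 8 ≤ size (extend wrapTemplate s B) := by
  simp [size, extend, encodeBodies, wrapTemplate, Template.inst, encodeRawRule, encodeRawSymbol,
    Ref.index, length_encodeUnary]
  omega

theorem size_pads (e : Bool) (s n : ℕ) (B : List Body) : size B + n ≤ size (pads e s n B) := by
  induction n generalizing B with
  | zero => exact le_rfl
  | succ n ih =>
    have h₁ := ih (extend (bitTemplate e) s B)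
    have h₂ := size_extend (bitTemplate e) s B
    rw [pads, Function.iterate_succ_apply, ← pads]
    omega

theorem extend_ne_nil (τ : Template) (s : ℕ) (B : List Body) : extend τ s B ≠ [] :=
  List.cons_ne_nil _ _

theorem pads_ne_nil (e : Bool) (s n : ℕ) {B : List Body} (hB : B ≠ []) : pads e s n B ≠ [] := by
  induction n generalizing B with
  | zero => exact hB
  | succ n ih => exact ih (extend_ne_nil _ _ _)

/-- Add definitions that halve the value, until the exponent for scaling is used up. -/
def padLoop (e : Bool) : Prog :=
  .seq (.basic [popMore .bud])
    (.loop Reg.more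
      (.seq (.basic [put .used .tick, .load fun r => { r with more := false }])
        (.seq (define (bitTemplate e)) (.basic [popMore .bud]))))

/-- Restore the exponent for scaling. -/
def restore : Prog :=
  .seq (.basic [popMore .used]) (.loop Reg.more (.basic [put .bud .tick, popMore .used]))

/-- Make the nonterminal defined last, whose number is one less than the number of nonterminals,
the distinguished one. -/
def copyIndex : Prog :=
  .seq (.basic [drop .cur, popMore .cur])
    (.seq (.loop Reg.more (.basic [put .tmp .tick, put .sidx .tick, popMore .cur]))
      (.seq (.basic [popMore .tmp])
        (.seq (.loop Reg.more (.basic [put .cur .tick, popMore .tmp]))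
          (.basic [put .cur .tick]))))

/-- Scale the value, and combine it with that of the distinguished nonterminal. -/
def finish (e : Bool) : Prog :=
  .seq (padLoop e) (.seq restore (.seq (define wrapTemplate) (.seq (clear .sidx) copyIndex)))

section Specs

variable {r : Reg} {i : List Token}

/-- Eight steps per unit of growth pay for the definitions; the other eight cover the loop, since
every round adds at least one unit. -/
theorem runs_padLoop (hr : r.more = false) {B : List Body} (hB : B ≠ []) (e : Bool)
    (s m u a : ℕ) :
    Runs (padLoop e) (mem r i B s m u) (mem r i (pads e s m B) s 0 (u + m)) (a + 16 * size B)
      (a + 16 * size (pads e s m B) + 2) := by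
  have h : ∀ (m u a : ℕ) (B : List Body), B ≠ [] → Runs (.loop Reg.more
      (.seq (.basic [put .used .tick, .load fun r => { r with more := false }])
        (.seq (define (bitTemplate e)) (.basic [popMore .bud]))))
      (mem (r.withMore m) i B s (m - 1) u) (mem r i (pads e s m B) s 0 (u + m))
      (a + 16 * size B) (a + 16 * size (pads e s m B) + 1) := by
    intro m
    induction m with
    | zero =>
      intro u a B hB
      rw [Reg.withMore_zero hr]
      exact .loopFalse hr le_rfl
    | succ m ih =>
      intro u a B hB
      have h₁ := runs_define hr (i := i) hB s m (u + 1) (bitTemplate e) (a + 2 + 8 * size B)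
      have h₂ := ih (u + 1) (a + 3 + 8 * size B) (extend (bitTemplate e) s B)
        (extend_ne_nil _ _ _)
      have h₃ := size_extend (bitTemplate e) s B
      have h₄ : Runs (.basic [popMore .bud]) (mem r i (extend (bitTemplate e) s B) s m (u + 1))
          (mem (r.withMore m) i (extend (bitTemplate e) s B) s (m - 1) (u + 1)) 0 1 := by
        refine .basic ?_ le_rfl
        rw [mem, mem, ← ticks_tail m]
        rfl
      have h₅ : Runs (.basic [put .used .tick, .load fun r => { r with more := false }])
          (mem (r.withMore (m + 1)) i B s m u) (mem r i B s m (u + 1)) 0 1 := by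
        refine .basic ?_ le_rfl
        rw [← Reg.withMore_zero hr]
        rfl
      rw [show u + (m + 1) = u + 1 + m by omega]
      obtain ⟨t₁, h₁, h₁'⟩ := h₁
      obtain ⟨t₂, h₂, h₂'⟩ := h₂
      obtain ⟨t₄, h₄, h₄'⟩ := h₄
      obtain ⟨t₅, h₅, h₅'⟩ := h₅
      refine ⟨_, Exec.loopTrue rfl (h₅.seq (h₁.seq h₄)) h₂, ?_⟩
      rw [pads, Function.iterate_succ_apply, ← pads]
      omega
  have h₀ : Runs (.basic [popMore .bud]) (mem r i B s m u) (mem (r.withMore m) i B s (m - 1) u)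
      (a + 16 * size B) (a + 16 * size B + 1) := by
    refine .basic ?_ le_rfl
    rw [mem, mem, ← ticks_tail m]
    rfl
  exact (h₀.seq ((h m u (a + 1) B hB).mono (by omega))).mono
    (b := a + 16 * size (pads e s m B) + 2) (by omega)

theorem runs_restore (hr : r.more = false) (B : List Body) (s m u a : ℕ) :
    Runs restore (mem r i B s m u) (mem r i B s (u + m) 0) a (a + 2 * u + 2) := by
  have h : ∀ u m a : ℕ, Runs (.loop Reg.more (.basic [put .bud .tick, popMore .used]))
      (mem (r.withMore u) i B s m (u - 1)) (mem r i B s (u + m) 0) a (a + 2 * u + 1) := by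
    intro u
    induction u with
    | zero =>
      intro m a
      rw [Reg.withMore_zero hr, Nat.zero_add]
      exact .loopFalse hr le_rfl
    | succ u ih =>
      intro m a
      have h₁ := ih (m + 1) (a + 2)
      rw [show u + (m + 1) = u + 1 + m by omega] at h₁
      refine (Runs.loopTrue rfl (.basic ?_ le_rfl) h₁).mono (by omega)
      rw [mem, mem, ← ticks_tail u]
      rfl
  refine (Runs.seq (.basic ?_ le_rfl) (h u m (a + 1))).mono (by omega)
  rw [mem, mem, ← ticks_tail u]
  rfl

theorem runs_copyIndex (hr : r.more = false) {o b u : List Token} (n a : ℕ) :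
    Runs copyIndex ⟨r, i, o, ticks (n + 1), [], [], b, u⟩
      ⟨r, i, o, ticks (n + 1), ticks n, [], b, u⟩ a (a + 4 * n + 5) := by
  have h₁ : ∀ (n a : ℕ) (s t : List Token),
      Runs (.loop Reg.more (.basic [put .tmp .tick, put .sidx .tick, popMore .cur]))
        ⟨r.withMore n, i, o, (ticks n).tail, s, t, b, u⟩
        ⟨r, i, o, [], ticks n ++ s, ticks n ++ t, b, u⟩ a (a + 2 * n + 1) := by
    intro n
    induction n with
    | zero =>
      intro a s t
      rw [Reg.withMore_zero hr]
      exact .loopFalse hr le_rfl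
    | succ n ih =>
      intro a s t
      have := ih (a + 2) (.tick :: s) (.tick :: t)
      rw [ticks_append_cons, ticks_append_cons] at this
      exact (Runs.loopTrue rfl (.basic rfl le_rfl) this).mono (by omega)
  have h₂ : ∀ (n a : ℕ) (c s : List Token),
      Runs (.loop Reg.more (.basic [put .cur .tick, popMore .tmp]))
        ⟨r.withMore n, i, o, c, s, (ticks n).tail, b, u⟩
        ⟨r, i, o, ticks n ++ c, s, [], b, u⟩ a (a + 2 * n + 1) := by
    intro n
    induction n with
    | zero =>
      intro a c s
      rw [Reg.withMore_zero hr]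
      exact .loopFalse hr le_rfl
    | succ n ih =>
      intro a c s
      have := ih (a + 2) (.tick :: c) s
      rw [ticks_append_cons] at this
      exact (Runs.loopTrue rfl (.basic rfl le_rfl) this).mono (by omega)
  have h₁ := h₁ n (a + 1) [] []
  have h₂ := h₂ n (a + 1 + 2 * n + 1 + 1) [] (ticks n)
  rw [List.append_nil] at h₁ h₂
  exact ((Runs.basic rfl le_rfl).seq (h₁.seq ((Runs.basic rfl le_rfl).seq (h₂.seq
    (.basic rfl le_rfl))))).mono (by omega)

/-- Restoring the budget takes time proportional to `u + m`: the part from `m` is paid for by the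
padding definitions, and the part from `u` is the extra term. -/
theorem runs_finish (hr : r.more = false) {B : List Body} (hB : B ≠ []) (e : Bool)
    (s m u a : ℕ) :
    Runs (finish e) (mem r i B s m u)
      (mem r i (extend wrapTemplate s (pads e s m B)) (pads e s m B).length (u + m) 0)
      (a + 20 * size B) (a + 20 * size (extend wrapTemplate s (pads e s m B)) + 2 * u) := by
  have h₁ := runs_padLoop (i := i) hr hB e s m u 0
  have h₂ := runs_restore (i := i) hr (pads e s m B) s 0 (u + m) 0
  have h₃ := runs_define (i := i) hr (pads_ne_nil e s m hB) s (u + m) 0 wrapTemplate 0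
  have h₄ := runs_clear_sidx (i := i)
    (o := encodeBodies (extend wrapTemplate s (pads e s m B)) ++ [.fin])
    (c := ticks (extend wrapTemplate s (pads e s m B)).length) (t := []) (b := ticks (u + m))
    (u := ticks 0) (n := s) (a := 0) hr
  have h₅ := runs_copyIndex (i := i)
    (o := encodeBodies (extend wrapTemplate s (pads e s m B)) ++ [.fin]) (b := ticks (u + m))
    (u := ticks 0) hr (pads e s m B).length 0
  have g₁ := size_pads e s m B
  have g₂ := size_extend_wrapTemplate s (pads e s m B)
  rw [Nat.add_zero] at h₂
  obtain ⟨t₁, h₁, h₁'⟩ := h₁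
  obtain ⟨t₂, h₂, h₂'⟩ := h₂
  obtain ⟨t₃, h₃, h₃'⟩ := h₃
  obtain ⟨t₄, h₄, h₄'⟩ := h₄
  obtain ⟨t₅, h₅, h₅'⟩ := h₅
  exact ⟨_, h₁.seq (h₂.seq (h₃.seq (h₄.seq h₅))), by omega⟩

end Specs

/-! ### Reading binary numbers -/

/-- Whether the token read last is a bit. -/
def Reg.isBit (r : Reg) : Bool :=
  match r.tok with
  | some (.bit _) => true
  | _ => false

/-- Whether the token read last is the bit `1`. -/
def Reg.isOne (r : Reg) : Bool :=
  match r.tok with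
  | some (.bit b) => b
  | _ => false

/-- The definitions for the bits of a natural number. -/
def constLoop : Prog :=
  .loop Reg.isBit
    (.seq (.ite Reg.isOne (define (bitTemplate true)) (define (bitTemplate false)))
      (.basic [drop .bud, put .used .tick, popTok .inp]))

/-- Keep back a bit. -/
def shift : Instr := .load fun r => { r with u := r.v, v := r.isOne, par := !r.par }

/-- The definitions for the bits of a radicand. -/
def chainLoop : Prog :=
  .loop Reg.isBit
    (.seq (.ite Reg.u (define (bitTemplate false)) (define (bitTemplate true)))
      (.ite Reg.par (.basic [shift, popTok .inp])
        (.basic [shift, drop .bud, put .used .tick, popTok .inp])))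

/-- The definition of a root. -/
def writeRoot : Prog :=
  .ite Reg.v
    (.seq (.ite Reg.par
      (.ite Reg.u (define (rootTemplate true true)) (define (rootTemplate true false)))
      (.ite Reg.u (define (rootTemplate false true)) (define (rootTemplate false false))))
      (define (bitTemplate false)))
    (.basic [])

/-- The definitions for a square root. -/
def writeItem : Prog :=
  .seq (define [[.cls 0]])
    (.seq (.basic [put .bud .tick, .load fun r => { r with u := false, v := false, par := false }])
      (.seq chainLoop (.seq writeRoot (finish true))))

/-- The definitions for the square roots. -/
def itemLoop : Prog :=
  .loop (fun r => decide (r.tok ≠ some .fin)) (.seq writeItem (.basic [popTok .inp]))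

/-- Replace the token read last. -/
abbrev Reg.withTok (r : Reg) (t : Option Token) : Reg := { r with tok := t }

/-- The control memory while the bits of a radicand are read. -/
abbrev Reg.withChain (r : Reg) (t : Option Token) (Z : Chain) : Reg :=
  { r with tok := t, u := Z.u, v := Z.v, par := Z.par }

/-- A number in binary, followed by other tokens. -/
abbrev bitsThen (l : List Bool) (rest : List Token) : List Token :=
  l.map .bit ++ .comma :: rest

theorem encodeBinary_append (d : ℕ) (l : List Token) :
    encodeBinary d ++ l = bitsThen d.bits l := by
  simp [encodeBinary, bitsThen]

section Specs

variable {r : Reg}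

theorem size_foldl_bitTemplate (s : ℕ) (l : List Bool) (B : List Body) :
    size B + l.length ≤ size (l.foldl (fun B b => extend (bitTemplate b) s B) B) := by
  induction l generalizing B with
  | nil => exact le_rfl
  | cons b l ih =>
    have h₁ := ih (extend (bitTemplate b) s B)
    have h₂ := size_extend (bitTemplate b) s B
    rw [List.foldl_cons, List.length_cons]
    omega

/-- Each bit moves a tick from `bud` to `used`, so what remains in `bud` is the number of paddings
still needed. The current token is already in the register when a round begins. -/
theorem runs_constLoop (hr : r.more = false) (rest : List Token) (s : ℕ) (l : List Bool) :
    ∀ {B : List Body}, B ≠ [] → ∀ m u a : ℕ,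
    Runs constLoop (mem (r.withTok (bitsThen l rest).head?) (bitsThen l rest).tail B s m u)
      (mem (r.withTok (some .comma)) rest
        (l.foldl (fun B b => extend (bitTemplate b) s B) B) s (m - l.length) (u + l.length))
      (a + 16 * size B)
      (a + 16 * size (l.foldl (fun B b => extend (bitTemplate b) s B) B) + 1) := by
  induction l with
  | nil => intro B hB m u a; exact .loopFalse rfl le_rfl
  | cons b l ih =>
    intro B hB m u a
    have h₁ := runs_define (r := r.withTok (some (.bit b))) hr (i := bitsThen l rest) hB s m u
      (bitTemplate b) 0
    have h₂ : Exec (.basic [drop .bud, put .used .tick, popTok .inp])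
        (mem (r.withTok (some (.bit b))) (bitsThen l rest) (extend (bitTemplate b) s B) s m u)
        (mem (r.withTok (bitsThen l rest).head?) (bitsThen l rest).tail
          (extend (bitTemplate b) s B) s (m - 1) (u + 1)) 1 := by
      refine .basic' ?_
      rw [mem, mem, ← ticks_tail]
      rfl
    have h₃ := ih (extend_ne_nil (bitTemplate b) s B) (m - 1) (u + 1) 0
    have h₄ := size_extend (bitTemplate b) s B
    obtain ⟨t₁, h₁, h₁'⟩ := h₁
    obtain ⟨t₃, h₃, h₃'⟩ := h₃
    rw [List.foldl_cons, List.length_cons, show m - (l.length + 1) = m - 1 - l.length by omega,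
      show u + (l.length + 1) = u + 1 + l.length by omega]
    have h₅ : Exec (.ite Reg.isOne (define (bitTemplate true)) (define (bitTemplate false)))
        (mem (r.withTok (some (.bit b))) (bitsThen l rest) B s m u)
        (mem (r.withTok (some (.bit b))) (bitsThen l rest) (extend (bitTemplate b) s B) s m u)
        (t₁ + 1) := by
      cases b
      · exact .iteFalse rfl h₁
      · exact .iteTrue rfl h₁
    exact ⟨_, Exec.loopTrue rfl (h₅.seq h₂) h₃, by omega⟩

theorem size_foldl_step (s : ℕ) (l : List Bool) (Z : Chain) :
    size Z.bodies + l.length ≤ size (l.foldl (Chain.step s) Z).bodies := by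
  induction l generalizing Z with
  | nil => exact le_rfl
  | cons b l ih =>
    have h₁ := ih (Z.step s b)
    have h₂ := size_extend (bitTemplate !Z.u) s Z.bodies
    simp only [Chain.step, List.foldl_cons, List.length_cons] at h₁ ⊢
    omega

theorem foldl_step_ne_nil (s : ℕ) (l : List Bool) {Z : Chain} (hZ : Z.bodies ≠ []) :
    (l.foldl (Chain.step s) Z).bodies ≠ [] := by
  induction l generalizing Z with
  | nil => exact hZ
  | cons b l ih => exact ih (Z := Z.step s b) (extend_ne_nil _ _ _)

/-- Half the length, rounded down if `par` and rounded up otherwise. -/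
def halfLength (par : Bool) (l : List Bool) : ℕ :=
  if par then l.length / 2 else (l.length + 1) / 2

theorem halfLength_cons (par b : Bool) (l : List Bool) :
    halfLength par (b :: l) = halfLength (!par) l + if par then 0 else 1 := by
  cases par <;> simp only [halfLength, List.length_cons, Bool.not_true, Bool.not_false,
    Bool.false_eq_true, if_false, if_true] <;> omega

/-- A tick is spent only on bits read while `par` is false. From the start of a radicand this is
every second bit beginning with the first, so half the length rounded up is spent without any
division. -/
theorem runs_chainLoop (hr : r.more = false) (rest : List Token) (s : ℕ) (l : List Bool) :
    ∀ {Z : Chain}, Z.bodies ≠ [] → ∀ m u a : ℕ,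
    Runs chainLoop
      (mem (r.withChain (bitsThen l rest).head? Z) (bitsThen l rest).tail Z.bodies s m u)
      (mem (r.withChain (some .comma) (l.foldl (Chain.step s) Z)) rest
        (l.foldl (Chain.step s) Z).bodies s (m - halfLength Z.par l) (u + halfLength Z.par l))
      (a + 16 * size Z.bodies) (a + 16 * size (l.foldl (Chain.step s) Z).bodies + 1) := by
  induction l with
  | nil =>
    intro Z hZ m u a
    have : halfLength Z.par [] = 0 := by cases Z.par <;> rfl
    rw [this]
    exact .loopFalse rfl le_rfl
  | cons b l ih =>
    rintro ⟨B, ub, vb, p⟩ hB m u a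
    have h₁ := runs_define (r := r.withChain (some (.bit b)) ⟨B, ub, vb, p⟩) hr
      (i := bitsThen l rest) hB s m u (bitTemplate !ub) 0
    have h₃ := ih (Z := Chain.step s ⟨B, ub, vb, p⟩ b) (extend_ne_nil _ _ _)
      (m - if p then 0 else 1) (u + if p then 0 else 1) 0
    have h₄ := size_extend (bitTemplate !ub) s B
    obtain ⟨t₁, h₁, h₁'⟩ := h₁
    obtain ⟨t₃, h₃, h₃'⟩ := h₃
    rw [List.foldl_cons, halfLength_cons]
    rw [show m - (halfLength (!p) l + if p then 0 else 1) =
        m - (if p then 0 else 1) - halfLength (!p) l by omega,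
      show u + (halfLength (!p) l + if p then 0 else 1) =
        u + (if p then 0 else 1) + halfLength (!p) l by omega]
    have h₅ : Exec (.ite Reg.u (define (bitTemplate false)) (define (bitTemplate true)))
        (mem (r.withChain (some (.bit b)) ⟨B, ub, vb, p⟩) (bitsThen l rest) B s m u)
        (mem (r.withChain (some (.bit b)) ⟨B, ub, vb, p⟩) (bitsThen l rest)
          (extend (bitTemplate !ub) s B) s m u) (t₁ + 1) := by
      cases ub
      · exact .iteFalse rfl h₁
      · exact .iteTrue rfl h₁
    have h₂ : Exec (.ite Reg.par (.basic [shift, popTok .inp])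
          (.basic [shift, drop .bud, put .used .tick, popTok .inp]))
        (mem (r.withChain (some (.bit b)) ⟨B, ub, vb, p⟩) (bitsThen l rest)
          (extend (bitTemplate !ub) s B) s m u)
        (mem (r.withChain (bitsThen l rest).head? (Chain.step s ⟨B, ub, vb, p⟩ b))
          (bitsThen l rest).tail (extend (bitTemplate !ub) s B) s (m - if p then 0 else 1)
          (u + if p then 0 else 1)) 2 := by
      cases p
      · refine .iteFalse rfl (.basic' ?_)
        simp only [Bool.false_eq_true, if_false]
        rw [mem, mem, ← ticks_tail]
        rfl
      · exact .iteTrue rfl (.basic' rfl)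
    refine ⟨_, Exec.loopTrue rfl (h₅.seq h₂) h₃, ?_⟩
    simp only [Chain.step] at h₁' h₃' h₄ ⊢
    omega

theorem size_root (s : ℕ) (Z : Chain) : size Z.bodies ≤ size (Z.root s) := by
  unfold Chain.root
  split_ifs
  · exact (Nat.le_succ _).trans ((size_extend (rootTemplate Z.par Z.u) s _).trans
      ((Nat.le_succ _).trans (size_extend _ s _)))
  · exact le_rfl

theorem root_ne_nil (s : ℕ) {Z : Chain} (hZ : Z.bodies ≠ []) : Z.root s ≠ [] := by
  unfold Chain.root
  split_ifs
  · exact extend_ne_nil _ _ _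
  · exact hZ

theorem runs_writeRoot (hr : r.more = false) (i : List Token) (t : Option Token) (s : ℕ)
    {Z : Chain} (hZ : Z.bodies ≠ []) (m u a : ℕ) :
    Runs writeRoot (mem (r.withChain t Z) i Z.bodies s m u)
      (mem (r.withChain t Z) i (Z.root s) s m u) (a + 16 * size Z.bodies)
      (a + 16 * size (Z.root s) + 2) := by
  rcases Z with ⟨B, ub, vb, p⟩
  cases vb
  · exact .iteFalse rfl (.basic rfl le_rfl)
  · have h₁ := runs_define (r := r.withChain t ⟨B, ub, true, p⟩) hr (i := i) hZ s m u
      (rootTemplate p ub) 0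
    have h₂ := runs_define (r := r.withChain t ⟨B, ub, true, p⟩) hr (i := i)
      (extend_ne_nil (rootTemplate p ub) s B) s m u (bitTemplate false) 0
    have h₃ := size_extend (rootTemplate p ub) s B
    obtain ⟨t₁, h₁, h₁'⟩ := h₁
    obtain ⟨t₂, h₂, h₂'⟩ := h₂
    have h₄ : Exec (.ite Reg.par
        (.ite Reg.u (define (rootTemplate true true)) (define (rootTemplate true false)))
        (.ite Reg.u (define (rootTemplate false true)) (define (rootTemplate false false))))
        (mem (r.withChain t ⟨B, ub, true, p⟩) i B s m u)
        (mem (r.withChain t ⟨B, ub, true, p⟩) i (extend (rootTemplate p ub) s B) s m u)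
        (t₁ + 1 + 1) := by
      cases p <;> cases ub
      · exact .iteFalse rfl (.iteFalse rfl h₁)
      · exact .iteFalse rfl (.iteTrue rfl h₁)
      · exact .iteTrue rfl (.iteFalse rfl h₁)
      · exact .iteTrue rfl (.iteTrue rfl h₁)
    have h₅ := size_extend (bitTemplate false) s (extend (rootTemplate p ub) s B)
    refine ⟨_, Exec.iteTrue rfl (h₄.seq h₂), ?_⟩
    simp only [Chain.root, if_true] at h₁' h₂' ⊢
    omega

theorem size_buildRoot (st : Build) (bits : List Bool) :
    size st.bodies + bits.length + 9 ≤ size (buildRoot st bits).bodies := by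
  have h₁ := size_extend [[.cls 0]] st.s st.bodies
  have h₂ := size_foldl_step st.s bits (Chain.start st.s st.bodies)
  have h₃ := size_root st.s (bits.foldl (Chain.step st.s) (Chain.start st.s st.bodies))
  have h₄ := size_pads true st.s (st.m + 1 - (bits.length + 1) / 2)
    (Chain.root st.s (bits.foldl (Chain.step st.s) (Chain.start st.s st.bodies)))
  have h₅ := size_extend_wrapTemplate st.s (pads true st.s (st.m + 1 - (bits.length + 1) / 2)
    (Chain.root st.s (bits.foldl (Chain.step st.s) (Chain.start st.s st.bodies))))
  simp only [Chain.start, buildRoot] at *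
  omega

/-- The added tick in `bud` raises `m` by one. The control memory keeps traces of the last radicand;
afterwards only `more` and the operator matter. -/
theorem runs_writeItem (hr : r.more = false) {st : Build} (hB : st.bodies ≠ [])
    (rest : List Token) {l : List Bool} (hl : l.length ≤ st.m) (a : ℕ) :
    ∃ r' : Reg, r'.more = false ∧ r'.op = r.op ∧
    Runs writeItem (mem (r.withTok (bitsThen l rest).head?) (bitsThen l rest).tail st.bodies st.s
        st.m 0)
      (mem r' rest (buildRoot st l).bodies (buildRoot st l).s (buildRoot st l).m 0)
      (a + 24 * size st.bodies) (a + 24 * size (buildRoot st l).bodies - 8) := by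
  let Z₀ := Chain.start st.s st.bodies
  let Z := l.foldl (Chain.step st.s) Z₀
  have hZ₀ : Z₀.bodies ≠ [] := extend_ne_nil _ _ _
  have hZ : Z.bodies ≠ [] := foldl_step_ne_nil _ _ hZ₀
  refine ⟨r.withChain (some .comma) Z, hr, rfl, ?_⟩
  have h₁ := runs_define (r := r.withTok (bitsThen l rest).head?) hr
    (i := (bitsThen l rest).tail) hB st.s st.m 0 [[.cls 0]] 0
  have h₂ : Exec (.basic [put .bud .tick,
      .load fun r => { r with u := false, v := false, par := false }])
      (mem (r.withTok (bitsThen l rest).head?) (bitsThen l rest).tail Z₀.bodies st.s st.m 0)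
      (mem (r.withChain (bitsThen l rest).head? Z₀) (bitsThen l rest).tail Z₀.bodies st.s
        (st.m + 1) 0) 1 := .basic' rfl
  have h₃ := runs_chainLoop hr rest st.s l hZ₀ (st.m + 1) 0 0
  have h₄ := runs_writeRoot hr rest (some .comma) st.s hZ (st.m + 1 - (l.length + 1) / 2)
    (0 + (l.length + 1) / 2) 0
  have h₅ := runs_finish (r := r.withChain (some .comma) Z) (i := rest) hr (root_ne_nil st.s hZ)
    true st.s (st.m + 1 - (l.length + 1) / 2) (0 + (l.length + 1) / 2) 0
  rw [show 0 + (l.length + 1) / 2 + (st.m + 1 - (l.length + 1) / 2) = st.m + 1 by omega] at h₅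
  have g₁ := size_extend [[.cls 0]] st.s st.bodies
  have g₂ := size_foldl_step st.s l Z₀
  have g₃ := size_root st.s Z
  have g₄ := size_pads true st.s (st.m + 1 - (l.length + 1) / 2) (Z.root st.s)
  have g₅ := size_extend_wrapTemplate st.s
    (pads true st.s (st.m + 1 - (l.length + 1) / 2) (Z.root st.s))
  obtain ⟨t₁, h₁, h₁'⟩ := h₁
  obtain ⟨t₃, h₃, h₃'⟩ := h₃
  obtain ⟨t₄, h₄, h₄'⟩ := h₄
  obtain ⟨t₅, h₅, h₅'⟩ := h₅
  refine ⟨_, h₁.seq (h₂.seq (h₃.seq (h₄.seq h₅))), ?_⟩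
  simp only [Z, Z₀, Chain.start, buildRoot] at *
  omega

theorem buildRoot_ne_nil (st : Build) (bits : List Bool) : (buildRoot st bits).bodies ≠ [] :=
  extend_ne_nil _ _ _

theorem runs_itemLoop (ds : List ℕ) : ∀ {r : Reg}, r.more = false → ∀ {st : Build},
    st.bodies ≠ [] → (∀ d ∈ ds, d.bits.length ≤ st.m) → ∀ a : ℕ,
    ∃ r' : Reg, r'.more = false ∧ r'.op = r.op ∧
    Runs itemLoop
      (mem (r.withTok (ds.flatMap encodeBinary ++ [Token.fin]).head?)
        (ds.flatMap encodeBinary ++ [Token.fin]).tail st.bodies st.s st.m 0)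
      (mem r' [] (buildRoots st ds).bodies (buildRoots st ds).s (buildRoots st ds).m 0)
      (a + 24 * size st.bodies) (a + 24 * size (buildRoots st ds).bodies + 1) := by
  induction ds with
  | nil =>
    intro r hr st hB hm a
    exact ⟨r.withTok (some .fin), hr, rfl, Runs.loopFalse rfl le_rfl⟩
  | cons d ds ih =>
    intro r hr st hB hm a
    rw [List.flatMap_cons, List.append_assoc, encodeBinary_append]
    obtain ⟨r₁, hr₁, ho₁, t₁, h₁, h₁'⟩ := runs_writeItem hr hB
      (ds.flatMap encodeBinary ++ [Token.fin]) (hm d (by simp)) 0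
    obtain ⟨r₂, hr₂, ho₂, t₂, h₂, h₂'⟩ := ih hr₁ (st := buildRoot st d.bits)
      (buildRoot_ne_nil _ _) (fun e he => (hm e (by simp [he])).trans (Nat.le_succ _)) 0
    refine ⟨r₂, hr₂, ho₂.trans ho₁, _, Exec.loopTrue ?_ (h₁.seq (.basic' rfl)) h₂, ?_⟩
    -- The token read last is a bit, or the comma if d = 0, so it is not the end marker.
    · rcases hl : d.bits with _ | ⟨b, l⟩ <;> simp [mem, bitsThen]
    -- The growth of the size ensures that the subtraction of 8 in the bound for an item is not
    -- truncated; the 8 steps saved cover the loop test and the reading of the next token.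
    · have := size_buildRoot st d.bits
      have e : buildRoots st (d :: ds) = buildRoots (buildRoot st d.bits) ds := rfl
      rw [e]
      omega

end Specs


/-! ### The length of the constructed grammar -/

theorem length_foldl_bitTemplate (s : ℕ) (l : List Bool) (B : List Body) :
    (l.foldl (fun B b => extend (bitTemplate b) s B) B).length = B.length + l.length := by
  induction l generalizing B with
  | nil => rfl
  | cons b l ih =>
    rw [List.foldl_cons, ih, extend, List.length_cons, List.length_cons]
    omega

theorem length_foldl_step (s : ℕ) (l : List Bool) (Z : Chain) :
    (l.foldl (Chain.step s) Z).bodies.length = Z.bodies.length + l.length := by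
  induction l generalizing Z with
  | nil => rfl
  | cons b l ih =>
    rw [List.foldl_cons, ih, Chain.step, extend, List.length_cons, List.length_cons]
    omega

theorem length_pads (e : Bool) (s n : ℕ) (B : List Body) :
    (pads e s n B).length = B.length + n := by
  induction n generalizing B with
  | zero => rfl
  | succ n ih =>
    rw [pads, Function.iterate_succ_apply, ← pads, ih, extend, List.length_cons]
    omega

theorem length_root_le (s : ℕ) (Z : Chain) : (Z.root s).length ≤ Z.bodies.length + 2 := by
  unfold Chain.root
  split_ifs <;> simp [extend]

theorem length_buildConst_le (m : ℕ) (bits : List Bool) :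
    (buildConst m bits).bodies.length ≤ m + bits.length + 7 := by
  rw [buildConst, extend, List.length_cons, length_pads, length_foldl_bitTemplate,
    show initialBodies.length = 6 from rfl]
  omega

theorem length_buildRoot_le (st : Build) (bits : List Bool) :
    (buildRoot st bits).bodies.length ≤ st.bodies.length + (bits.length + st.m + 5) := by
  have := length_root_le st.s (bits.foldl (Chain.step st.s) (Chain.start st.s st.bodies))
  rw [length_foldl_step, Chain.start, extend, List.length_cons] at this
  rw [buildRoot, extend, List.length_cons, length_pads]
  simp only [Chain.start, extend]
  omega

theorem buildRoots_m (st : Build) (ds : List ℕ) : (buildRoots st ds).m = st.m + ds.length := by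
  induction ds generalizing st with
  | nil => rfl
  | cons d ds ih =>
    refine (ih (buildRoot st d.bits)).trans ?_
    rw [show (buildRoot st d.bits).m = st.m + 1 from rfl, List.length_cons]
    omega

theorem length_buildRoots_le {n : ℕ} {ds : List ℕ} {st : Build}
    (hn : ∀ d ∈ ds, d.bits.length ≤ n) :
    (buildRoots st ds).bodies.length ≤
      st.bodies.length + ds.length * (n + (st.m + ds.length) + 5) := by
  induction ds generalizing st with
  | nil => exact Nat.le_add_right _ _
  | cons d ds ih =>
    have h₁ := ih (st := buildRoot st d.bits) fun e he => hn e (by simp [he])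
    have h₂ := length_buildRoot_le st d.bits
    have h₃ := hn d (by simp)
    have h₄ : (buildRoot st d.bits).m = st.m + 1 := rfl
    rw [h₄, show st.m + 1 + ds.length = st.m + (ds.length + 1) by omega] at h₁
    refine h₁.trans ?_
    rw [List.length_cons, Nat.add_mul, Nat.one_mul]
    omega

namespace SqrtSumInstance

variable (x : SqrtSumInstance)

theorem length_ds_lt : x.ds.length < x.numbers.length := by
  have : x.ds.length ≤ (x.ds.flatMap encodeBinary).length := by
    rw [List.length_flatMap]
    refine (List.length_map (as := x.ds) fun d => (encodeBinary d).length).symm.le.trans ?_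
    refine List.length_le_sum_of_one_le _ fun k hk => ?_
    obtain ⟨d, -, rfl⟩ := List.mem_map.1 hk
    simp [encodeBinary]
  simp only [numbers, List.length_append, List.length_singleton]
  omega

theorem build_m : x.build.m = x.numbers.length + x.ds.length := buildRoots_m _ _

/-- With N the length of the numbers part, d₀ leads to at most 2N + 7 definitions, and each of fewer
than N radicands to at most 3N + 5 more. -/
theorem length_build_le :
    x.build.bodies.length ≤ 3 * x.numbers.length ^ 2 + 7 * x.numbers.length + 7 := by
  have h₁ := length_buildRoots_le (st := buildConst x.numbers.length x.d₀.bits)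
    x.length_bits_le_of_mem
  have h₂ := length_buildConst_le x.numbers.length x.d₀.bits
  have h₃ := x.length_bits_le
  have h₄ := x.length_ds_lt
  have h₅ : (buildConst x.numbers.length x.d₀.bits).m = x.numbers.length := rfl
  rw [h₅] at h₁
  refine h₁.trans ?_
  have h₆ := Nat.mul_le_mul h₄.le
    (show x.numbers.length + (x.numbers.length + x.ds.length) + 5 ≤ 3 * x.numbers.length + 5
      by omega)
  linarith

theorem size_build_le :
    size x.build.bodies ≤ x.build.bodies.length * (16 * x.build.bodies.length + 200) :=
  x.goodState_build.size_le

end SqrtSumInstance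

/-! ### The program -/

/-- Write the length of the input in unary, and preserve the input. -/
def countLoop : Prog :=
  .seq (.basic [popTok .inp])
    (.seq (.loop (fun r => r.tok.isSome)
        (.basic [.push .tmp fun r => r.tok.getD .comma, put .bud .tick, popTok .inp]))
      (.seq (.basic [popTok .tmp]) (.loop (fun r => r.tok.isSome)
        (.basic [.push .inp fun r => r.tok.getD .comma, popTok .tmp]))))

/-- The word is reversed onto `tmp` and back, leaving one tick per token. Its length serves as the
initial `m`, a bound for all bit lengths that needs no comparison of numbers. -/
theorem runs_countLoop {r : Reg} (l o c s b u : List Token) (a : ℕ) :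
    Runs countLoop ⟨r, l, o, c, s, [], b, u⟩
      ⟨r.withTok none, l, o, c, s, [], ticks l.length ++ b, u⟩ a (a + 4 * l.length + 4) := by
  have h₁ : ∀ (l t b : List Token) (a : ℕ), Runs (.loop (fun r => r.tok.isSome)
        (.basic [.push .tmp fun r => r.tok.getD .comma, put .bud .tick, popTok .inp]))
      ⟨r.withTok l.head?, l.tail, o, c, s, t, b, u⟩
      ⟨r.withTok none, [], o, c, s, l.reverse ++ t, ticks l.length ++ b, u⟩ a
      (a + 2 * l.length + 1) := by
    intro l
    induction l with
    | nil => intro t b a; exact .loopFalse rfl le_rfl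
    | cons x l ih =>
      intro t b a
      have := ih (x :: t) (.tick :: b) (a + 2)
      rw [ticks_append_cons] at this
      rw [List.reverse_cons, List.append_assoc]
      exact (Runs.loopTrue rfl (.basic rfl le_rfl) this).mono (by rw [List.length_cons]; omega)
  have h₂ : ∀ (t l b : List Token) (a : ℕ), Runs (.loop (fun r => r.tok.isSome)
        (.basic [.push .inp fun r => r.tok.getD .comma, popTok .tmp]))
      ⟨r.withTok t.head?, l, o, c, s, t.tail, b, u⟩
      ⟨r.withTok none, t.reverse ++ l, o, c, s, [], b, u⟩ a (a + 2 * t.length + 1) := by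
    intro t
    induction t with
    | nil => intro l b a; exact .loopFalse rfl le_rfl
    | cons x t ih =>
      intro l b a
      have := ih (x :: l) b (a + 2)
      rw [List.reverse_cons, List.append_assoc]
      exact (Runs.loopTrue rfl (.basic rfl le_rfl) this).mono (by rw [List.length_cons]; omega)
  have h₁ := h₁ l [] b (a + 1)
  have h₂ := h₂ l.reverse [] (ticks l.length ++ b) (a + 1 + 2 * l.length + 1 + 1)
  rw [List.append_nil] at h₁
  rw [List.append_nil, List.reverse_reverse, List.length_reverse] at h₂
  exact ((Runs.basic rfl le_rfl).seq (h₁.seq ((Runs.basic rfl le_rfl).seq h₂))).mono (by omega)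

/-- Read the comparison operator. -/
def readOp : Prog :=
  .basic [.pop .inp fun r t => { r with op := match t with | some (.op q) => q | _ => r.op }]

/-- Write the initial definitions. -/
def writeInitial : Prog :=
  .basic (puts .out (encodeBodies initialBodies ++ [.fin]) ++
    [put .cur .tick, put .cur .tick, put .cur .tick, put .cur .tick, put .cur .tick,
      put .cur .tick, put .sidx .tick, put .sidx .tick, put .sidx .tick, put .sidx .tick,
      popTok .inp])

/-- Complete the encoding, and clear the memory. -/
def writeHeader : Prog :=
  .seq (writeUnary .sidx) (.seq (clear .sidx) (.seq (writeUnary .cur) (.seq (clear .cur)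
    (.seq (clear .bud)
      (.seq (.basic (puts .out (encodeBinary 1 ++ (encodeBinary 128 ++ encodeUnary 31))))
        (.basic [.push .out fun r => .op r.op.swap, .load fun _ => Reg.init]))))))

/-- The program that computes the reduction. -/
def program : Prog :=
  .seq readOp (.seq countLoop (.seq writeInitial (.seq constLoop (.seq (finish false)
    (.seq (.basic [popTok .inp]) (.seq itemLoop writeHeader))))))

/-- The header comes last because the output is written back to front. Clearing the stacks and
resetting the control memory reaches the prescribed halting configuration. -/
theorem runs_writeHeader {r : Reg} (hr : r.more = false) (B : List Body) (s m a : ℕ) :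
    Runs writeHeader (mem r [] B s m 0)
      (.ofOutput (.op r.op.swap :: (encodeBinary 1 ++ (encodeBinary 128 ++ (encodeUnary 31 ++
        (encodeUnary B.length ++ (encodeUnary s ++ (encodeBodies B ++ [.fin]))))))))
      a (a + 6 * s + 6 * B.length + 2 * m + 16) := by
  have h : Exec (.basic (puts .out (encodeBinary 1 ++ (encodeBinary 128 ++ encodeUnary 31))))
      ⟨r, [], encodeUnary B.length ++ (encodeUnary s ++ (encodeBodies B ++ [.fin])), [], [], [],
        [], []⟩
      ⟨r, [], encodeBinary 1 ++ (encodeBinary 128 ++ (encodeUnary 31 ++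
        (encodeUnary B.length ++ (encodeUnary s ++ (encodeBodies B ++ [.fin]))))), [], [], [],
        [], []⟩ 1 := by
    refine .basic' ?_
    rw [foldl_puts_out, List.append_assoc, List.append_assoc]
  obtain ⟨t₁, h₁, h₁'⟩ := runs_writeUnary_sidx (i := []) (o := encodeBodies B ++ [.fin])
    (c := ticks B.length) (n := s) (b := ticks m) (u := ticks 0) (a := 0) hr
  obtain ⟨t₂, h₂, h₂'⟩ := runs_clear_sidx (i := []) (n := s)
    (o := encodeUnary s ++ (encodeBodies B ++ [.fin]))
    (c := ticks B.length) (t := []) (b := ticks m) (u := ticks 0) (a := 0) hr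
  obtain ⟨t₃, h₃, h₃'⟩ := runs_writeUnary_cur (i := [])
    (o := encodeUnary s ++ (encodeBodies B ++ [.fin]))
    (n := B.length) (s := []) (b := ticks m) (u := ticks 0) (a := 0) hr
  obtain ⟨t₄, h₄, h₄'⟩ := runs_clear_cur (i := [])
    (o := encodeUnary B.length ++ (encodeUnary s ++ (encodeBodies B ++ [.fin])))
    (n := B.length) (s := []) (t := []) (b := ticks m) (u := ticks 0) (a := 0) hr
  obtain ⟨t₅, h₅, h₅'⟩ := runs_clear_bud (i := [])
    (o := encodeUnary B.length ++ (encodeUnary s ++ (encodeBodies B ++ [.fin])))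
    (n := m) (s := []) (t := []) (c := []) (u := ticks 0) (a := 0) hr
  exact ⟨_, h₁.seq (h₂.seq (h₃.seq (h₄.seq (h₅.seq (h.seq (.basic' rfl)))))), by omega⟩

theorem length_le_size (B : List Body) : B.length ≤ size B := Nat.le_add_left _ _

/-- The construction costs 24 steps per unit of size. The header costs 12 more, since both indices
written there are at most the size; counting the input, restoring the first budget and clearing the
last one are linear in the input. -/
theorem runs_program (x : SqrtSumInstance) :
    Runs program (.ofInput x.encode) (.ofOutput x.reduce.encode) 0
      (36 * size x.build.bodies + 10 * x.numbers.length + 30) := by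
  let r₁ : Reg := { Reg.init with op := x.op }
  let rest := x.ds.flatMap encodeBinary ++ [Token.fin]
  let n := x.numbers.length
  let st := buildConst n x.d₀.bits
  have h₁ : Exec readOp (.ofInput x.encode) ⟨r₁, x.numbers, [], [], [], [], [], []⟩ 1 :=
    .basic' rfl
  obtain ⟨t₂, h₂, h₂'⟩ := runs_countLoop (r := r₁) x.numbers [] [] [] [] [] 0
  rw [List.append_nil] at h₂
  have h₃ : Exec writeInitial
      ⟨r₁.withTok none, x.numbers, [], [], [], [], ticks n, []⟩
      (mem (r₁.withTok (bitsThen x.d₀.bits rest).head?) (bitsThen x.d₀.bits rest).tail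
        initialBodies 4 n 0) 1 := by
    refine .basic' ?_
    rw [List.foldl_append, foldl_puts_out, List.append_nil, SqrtSumInstance.numbers,
      encodeBinary_append]
    rfl
  obtain ⟨t₄, h₄, h₄'⟩ := runs_constLoop (r := r₁) rfl rest 4 x.d₀.bits
    (B := initialBodies) (by simp [initialBodies]) n 0 0
  obtain ⟨t₅, h₅, h₅'⟩ := runs_finish (r := r₁.withTok (some .comma)) (i := rest) rfl
    (B := x.d₀.bits.foldl (fun B b => extend (bitTemplate b) 4 B) initialBodies)
    (by
      have := length_foldl_bitTemplate 4 x.d₀.bits initialBodies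
      refine List.ne_nil_of_length_pos ?_
      rw [this, show initialBodies.length = 6 from rfl]
      omega)
    false 4 (n - x.d₀.bits.length) (0 + x.d₀.bits.length) 0
  have hlen := x.length_bits_le
  rw [show 0 + x.d₀.bits.length + (n - x.d₀.bits.length) = n by omega] at h₅
  have h₆ : Exec (.basic [popTok .inp]) (mem (r₁.withTok (some .comma)) rest st.bodies st.s st.m 0)
      (mem (r₁.withTok rest.head?) rest.tail st.bodies st.s st.m 0) 1 := .basic' rfl
  obtain ⟨r₂, hr₂, ho₂, t₇, h₇, h₇'⟩ := runs_itemLoop x.ds (r := r₁) rfl (st := st)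
    (extend_ne_nil _ _ _) x.length_bits_le_of_mem 0
  obtain ⟨t₈, h₈, h₈'⟩ := runs_writeHeader hr₂ x.build.bodies x.build.s x.build.m 0
  rw [ho₂, ← x.encode_reduce] at h₈
  refine ⟨_, h₁.seq (h₂.seq (h₃.seq (h₄.seq (h₅.seq (h₆.seq (h₇.seq h₈)))))), ?_⟩
  have g₁ := length_le_size x.build.bodies
  have g₂ := x.goodState_build.lt
  have g₃ := x.build_m
  have g₄ := x.length_ds_lt
  have g₅ := size_foldl_bitTemplate 4 x.d₀.bits initialBodies
  have g₆ : size st.bodies = size (extend wrapTemplate 4 (pads false 4 (n - x.d₀.bits.length)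
    (x.d₀.bits.foldl (fun B b => extend (bitTemplate b) 4 B) initialBodies))) := rfl
  have g₇ : size (buildRoots st x.ds).bodies = size x.build.bodies := rfl
  have g₈ := size_pads false 4 (n - x.d₀.bits.length)
    (x.d₀.bits.foldl (fun B b => extend (bitTemplate b) 4 B) initialBodies)
  have g₉ := size_extend wrapTemplate 4 (pads false 4 (n - x.d₀.bits.length)
    (x.d₀.bits.foldl (fun B b => extend (bitTemplate b) 4 B) initialBodies))
  rw [g₇] at h₇'
  rw [← g₆] at h₅' g₉
  omega

/-- The bound for the running time. -/
noncomputable def timeBound : Polynomial ℕ :=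
  36 * ((3 * .X ^ 2 + 7 * .X + 7) * (16 * (3 * .X ^ 2 + 7 * .X + 7) + 200)) + 10 * .X + 30

theorem exec_program (x : SqrtSumInstance) :
    Exec program (.ofInput x.encode) (.ofOutput x.reduce.encode)
      (timeBound.eval x.encode.length) := by
  obtain ⟨t, h, ht⟩ := runs_program x
  refine h.mono (ht.trans ?_)
  have h₁ : x.numbers.length ≤ x.encode.length := Nat.le_succ _
  have h₂ : x.build.bodies.length ≤ 3 * x.encode.length ^ 2 + 7 * x.encode.length + 7 :=
    x.length_build_le.trans (by gcongr)
  have h₃ : size x.build.bodies ≤ (3 * x.encode.length ^ 2 + 7 * x.encode.length + 7) *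
      (16 * (3 * x.encode.length ^ 2 + 7 * x.encode.length + 7) + 200) :=
    x.size_build_le.trans (by gcongr)
  simp only [timeBound, Polynomial.eval_add, Polynomial.eval_mul, Polynomial.eval_pow,
    Polynomial.eval_X, Polynomial.eval_ofNat]
  gcongr

theorem mainTheorem3 : UCFGCoinFlipComparison.HardFor SQRTSUM :=
  ⟨SqrtSumInstance.reduce, program.computableInPolyTime timeBound exec_program,
    fun x => x.yes_reduce.symm⟩
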